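/- **Setting.** Let $P_X$ be a probability measure on $\mathbb R^p$, and let $f^{(1)},\dots,f^{(K)}\in L^2(P_X)$ be measurable and different, i.e. $\|f^{(k)}-f^{(l)}\|_{L^\infty(P_X)}>0$ for $k\ne l$. There are $L$ learners. Learner $i$ has a regression function $f_i\in\{f^{(1)},\dots,f^{(K)}\}$, and each $f^{(k)}$ is the regression function of at least one learner. Learner $i$ observes $n_i$ data points ($n_i$ even) $\mathcal D_i=\{(X_{i,j},Y_{i,j})\}_{j\le n_i}$ with $Y_{i,j}=f_i(X_{i,j})+\varepsilon_{i,j}$. The $X_{i,j}$ (over all $i,j$) are i.i.d. with law $P_X$, the family of all noises $\varepsilon_{i,j}$ is independent of the family of all $X_{i,j}$, and for each $i$ the $\varepsilon_{i,j}$, $j\ge1$, are i.i.d. $N(0,\sigma_i^2)$. **Candidate methods.** Learner $i$ has a finite set $\mathcal M_i=\mathcal M_i^{P}\cup\mathcal M_i^{N}$ of parametric and nonparametric methods. A method $\delta$ maps a data set of any size $n$ to a function $\hat f_{\delta,n}:\mathbb R^p\to\mathbb R$, jointly measurably in the data and the argument. Call $\delta$ *consistent* for learner $i$ if, when it is applied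 to the first $n$ points of learner $i$, both $$\int(\hat f_{\delta,n}-f_i)^2\,dP_X\quad\text{and}\quad \frac1n\sum_{j\le n}\bigl(\hat f_{\delta,n}(X_{i,j})-f_i(X_{i,j})\bigr)^2$$ tend to $0$ in probability as $n\to\infty$. Call $\delta$ *misspecified* for learner $i$ if there is $r>0$ such that $P_X(|\hat f_{\delta,n}-f_i|\ge r)\ge r$ with probability tending to one. Assume that each nonparametric candidate is consistent, that each parametric candidate is either consistent or misspecified, and that each learner has at least one consistent candidate. (No rates of convergence are required.) **The Select-Exchange-Cluster (SEC) method** with parameter $a>0$ and $K$ clusters. 1. *Select.* Learner $i$ fits every $\delta\in\mathcal M_i$ on the first half of $\mathcal D_i$, chooses a $\delta_i$ with the smallest mean squared error on the second half, and applies $\delta_i$ to all of $\mathcal D_i$ to get $\hat f_i$, with fitted error $\hat e_i=\frac1{n_i}\sum_{(x,y)\in\mathcal D_i}(y-\hat f_i(x))^2$. 2. *Exchange.* Put $\hat e_{i\to j}=\frac1{n_j}\sum_{(x,y)\in\mathcal D_j}(y-\hat f_i(x))^2$ and $v_{ij}=|\hat e_{i\to j}-\hat e_j|+|\hat e_{j\to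 i}-\hat e_i|$. 3. *Cluster.* Put $S=(\exp(-a v_{ij}))_{i,j}$ and $\Delta=\operatorname{diag}(\sum_j s_{ij})$. Let the columns of $U\in\mathbb R^{L\times K}$ be orthonormal eigenvectors of $\Delta^{-1/2}S\Delta^{-1/2}$ for its $K$ largest eigenvalues (with multiplicity), scale the rows of $U$ to unit Euclidean norm, giving $u_1,\dots,u_L$, and let the labels $c_1,\dots,c_L\in\{1,\dots,K\}$ minimize the $k$-means objective $\sum_{t=1}^K\frac1{2|S_t|}\sum_{i,j\in S_t}\|u_i-u_j\|^2$, $S_t=\{i:c_i=t\}$ (empty clusters contribute $0$). Ties, and the choice of eigenvectors, may be resolved in any way; each vector of labels that can arise is called an output of SEC. **Theorem 1.** Let $L$, $p$, $K$ and $a>0$ be fixed and let $n_i\to\infty$ for every $i$ (so $n=n_1+\dots+n_L\to\infty$). Then SEC always has at least one output, and, with probability tending to one, every output satisfies $$c_i=c_j\iff f_i=f_j\ \ (P_X\text{-a.e.})\qquad\text{for all } i,j\in\{1,\dots,L\}.$$ -/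

import Mathlib

open MeasureTheory ProbabilityTheory Filter Topology
open scoped NNReal ENNReal

noncomputable section

namespace SEC

/-- The predictor space `ℝ^p`. -/
abbrev Pred (p : ℕ) : Type := EuclideanSpace ℝ (Fin p)

/-- A data set of `n` points `(x, y)`. -/
abbrev Dataset (p n : ℕ) : Type := Fin n → Pred p × ℝ

/-- A regression method turns a data set of any size into an estimated regression function. -/
abbrev Method (p : ℕ) : Type := (n : ℕ) → Dataset p n → Pred p → ℝ

/-- The first half of a data set (training part). -/
def firstHalf {p n : ℕ} (D : Dataset p n) : Dataset p (n / 2) :=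
  fun j => D ⟨j, by omega⟩

/-- The second half of a data set (test part). -/
def secondHalf {p n : ℕ} (D : Dataset p n) : Dataset p (n / 2) :=
  fun j => D ⟨n / 2 + j, by omega⟩

/-- Mean squared error of the function `g` on the data set `D`. -/
def mse {p n : ℕ} (g : Pred p → ℝ) (D : Dataset p n) : ℝ :=
  (∑ j, ((D j).2 - g (D j).1) ^ 2) / n

/-! ### Step 1: select -/

/-- `δ` is a best method of `M` for half-half cross validation on `D`
(any minimizer is allowed when there are ties). -/
def IsSelected {p n : ℕ} (M : Set (Method p)) (D : Dataset p n) (δ : Method p) : Prop :=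
  δ ∈ M ∧ ∀ δ' ∈ M, mse (δ (n / 2) (firstHalf D)) (secondHalf D)
    ≤ mse (δ' (n / 2) (firstHalf D)) (secondHalf D)

/-! ### Step 2: exchange -/

/-- The dissimilarity
`v i j = |ê (i → j) - ê j| + |ê (j → i) - ê i|` of the learners `i`, `j`, where `g i` is the
estimated function of learner `i`, `ê (i → j)` is its loss on the data of learner `j`, and
`ê j` is the fitted error of learner `j`. The formula gives `0` for `i = j`. -/
def dissim {L p : ℕ} {n : Fin L → ℕ} (D : ∀ i, Dataset p (n i)) (g : Fin L → Pred p → ℝ)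
    (i j : Fin L) : ℝ :=
  |mse (g i) (D j) - mse (g j) (D j)| + |mse (g j) (D i) - mse (g i) (D i)|

/-- The similarity matrix `exp (-a v)`. -/
def similarity {L : ℕ} (a : ℝ) (v : Fin L → Fin L → ℝ) : Matrix (Fin L) (Fin L) ℝ :=
  Matrix.of fun i j => Real.exp (-a * v i j)

/-! ### Step 3: cluster -/

/-- The normalized matrix `Δ^(-1/2) S Δ^(-1/2)`, where `Δ` is the diagonal matrix of row sums. -/
def laplacian {L : ℕ} (S : Matrix (Fin L) (Fin L) ℝ) : Matrix (Fin L) (Fin L) ℝ :=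
  Matrix.diagonal (fun i => (Real.sqrt (∑ j, S i j))⁻¹) * S *
    Matrix.diagonal (fun i => (Real.sqrt (∑ j, S i j))⁻¹)

/-- The columns of `U` are orthonormal eigenvectors of the (symmetric) matrix `A` for its `K`
largest eigenvalues, counted with multiplicity: an eigenvector orthogonal to all the columns has
an eigenvalue which is at most each of the chosen ones. Any choice of eigenvectors is allowed;
the order of the columns is immaterial. -/
def IsTopEigenvectors {L K : ℕ} (A : Matrix (Fin L) (Fin L) ℝ)
    (U : Matrix (Fin L) (Fin K) ℝ) : Prop :=
  U.transpose * U = 1 ∧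
  ∃ d : Fin K → ℝ,
    (∀ k, A.mulVec (fun i => U i k) = d k • (fun i => U i k)) ∧
    ∀ (w : Fin L → ℝ) (c : ℝ), w ≠ 0 → A.mulVec w = c • w →
      (∀ k, (∑ i, U i k * w i) = 0) → ∀ k, c ≤ d k

/-- The `i`-th row of `U`, scaled to unit Euclidean norm. -/
def unitRow {L K : ℕ} (U : Matrix (Fin L) (Fin K) ℝ) (i : Fin L) : EuclideanSpace ℝ (Fin K) :=
  ‖(WithLp.toLp 2 (U i) : EuclideanSpace ℝ (Fin K))‖⁻¹ • WithLp.toLp 2 (U i)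

/-- The `k`-means objective of the labelling `c` of the points `u i`:
the sum over the clusters `t` of `(1 / (2 |S_t|)) ∑ ‖u i - u j‖ ^ 2` over all `i, j` in `S_t`. -/
def kmeansCost {L K : ℕ} (u : Fin L → EuclideanSpace ℝ (Fin K)) (c : Fin L → Fin K) : ℝ :=
  ∑ t : Fin K, (∑ i with c i = t, ∑ j with c j = t, ‖u i - u j‖ ^ 2) /
    (2 * ((Finset.univ.filter fun i => c i = t).card : ℝ))

/-- `c` is a `k`-means clustering of the points `u i` (a global minimizer). -/
def IsKMeans {L K : ℕ} (u : Fin L → EuclideanSpace ℝ (Fin K)) (c : Fin L → Fin K) : Prop :=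
  ∀ c' : Fin L → Fin K, kmeansCost u c ≤ kmeansCost u c'

/-- `c` is a vector of labels which the select-exchange-cluster method with tuning parameter `a`
and `K` clusters may output, when learner `i` has the candidate methods `M i` and the data
`D i`. -/
def IsOutput {L p : ℕ} {n : Fin L → ℕ} (M : Fin L → Set (Method p)) (a : ℝ) (K : ℕ)
    (D : ∀ i, Dataset p (n i)) (c : Fin L → Fin K) : Prop :=
  ∃ δ : Fin L → Method p, (∀ i, IsSelected (M i) (D i) (δ i)) ∧
  ∃ U : Matrix (Fin L) (Fin K) ℝ,
    IsTopEigenvectors (laplacian (similarity a (dissim D fun i => δ i (n i) (D i)))) U ∧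
    IsKMeans (unitRow U) c

/-! ### The data and the candidate methods -/

/-- The first `n` points `(X_j, f (X_j) + ε_j)` of a learner with regression function `f`. -/
def sample {Ω : Type*} {p : ℕ} (f : Pred p → ℝ) (X : ℕ → Ω → Pred p) (ε : ℕ → Ω → ℝ)
    (n : ℕ) (ω : Ω) : Dataset p n :=
  fun j => (X j ω, f (X j ω) + ε j ω)

/-- The method `δ` is consistent for `f`: the estimation error tends to zero in probability, in
the `L²` norm of the law `PX` of the predictors and in the `L²` norm of the empirical law of the
observed predictors. -/
def IsConsistent {Ω : Type*} [MeasurableSpace Ω] {p : ℕ} (μ : Measure Ω) (PX : Measure (Pred p))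
    (f : Pred p → ℝ) (X : ℕ → Ω → Pred p) (ε : ℕ → Ω → ℝ) (δ : Method p) : Prop :=
  (∀ η : ℝ, 0 < η → Tendsto (fun n => μ {ω |
      ENNReal.ofReal η ≤ eLpNorm (fun x => δ n (sample f X ε n ω) x - f x) 2 PX})
    atTop (𝓝 0)) ∧
  (∀ η : ℝ, 0 < η → Tendsto (fun n => μ {ω |
      η ≤ Real.sqrt
        ((∑ j : Fin n, (δ n (sample f X ε n ω) (X j ω) - f (X j ω)) ^ 2) / n)})
    atTop (𝓝 0))

/-- The method `δ` is misspecified for `f`: for some `r > 0`, with probability tending to one,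
its estimate differs from `f` by at least `r` on a set of `PX`-measure at least `r`. -/
def IsMisspecified {Ω : Type*} [MeasurableSpace Ω] {p : ℕ} (μ : Measure Ω)
    (PX : Measure (Pred p)) (f : Pred p → ℝ) (X : ℕ → Ω → Pred p) (ε : ℕ → Ω → ℝ)
    (δ : Method p) : Prop :=
  ∃ r : ℝ, 0 < r ∧ Tendsto (fun n => μ {ω |
      PX {x | r ≤ |δ n (sample f X ε n ω) x - f x|} < ENNReal.ofReal r})
    atTop (𝓝 0)

end SEC

end

namespace SEC

/-! The dissimilarities converge in probability to twice the squared `L²(P_X)` distances of the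
regression functions, and spectral clustering gives the correct answer on a whole neighbourhood of
that limit.

Convergence. A misspecified candidate has empirical squared error bounded below on the fresh second
half, a consistent one has vanishing error there, and the cross terms with the noise are negligible;
so a misspecified candidate is almost never selected (`tendsto_measure_mse_le_mse`). For a
consistent fit of learner `i`, the loss on the data of learner `j` tends to the noise variance of
`j` plus `‖f_i - f_j‖²` (`tendsto_measure_abs_exchanged_mse_sub`). The noise variances cancel in the
dissimilarity. Since the selected method depends on the outcome, the bad events are united over the
finitely many candidates.

Neighbourhood. At the limit the similarity is a Gaussian kernel evaluated at points of the Hilbert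
space `L²(P_X)`, one for each regression function. These points are distinct, so the `K × K` kernel
matrix is positive definite (`posDef_gaussianKernel`), and the normalized matrix is its rescaling,
repeated blockwise along the classes. Such a matrix has rank `K`; its top eigenvectors are constant
on classes and have orthogonal rows for different classes (`sum_mul_rows_of_submatrix`). The unit
rows are then `K` distinct points, on which the optimal `k`-means cost is zero and is attained only
by the true partition. Compactness extends this to nearby matrices
(`eventually_isKMeans_label_iff`), with no eigengap estimate or choice of eigenbasis; this is why no
rates are needed. -/

/-! ### Top eigenvectors of symmetric matrices. -/

theorem exists_isTopEigenvectors {L K : ℕ} (hKL : K ≤ L) {A : Matrix (Fin L) (Fin L) ℝ}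
    (hA : A.IsHermitian) : ∃ U : Matrix (Fin L) (Fin K) ℝ, IsTopEigenvectors A U := by
  let s := Tuple.sort (fun i => -hA.eigenvalues i)
  have hs : Monotone ((fun i => -hA.eigenvalues i) ∘ s) := Tuple.monotone_sort _
  let g : Fin K → Fin L := fun k => s (Fin.castLE hKL k)
  have hg : Function.Injective g := s.injective.comp (Fin.castLE_injective hKL)
  let b := hA.eigenvectorBasis
  refine ⟨Matrix.of fun i k => b (g k) i, ?_, fun k => hA.eigenvalues (g k), ?_, ?_⟩
  · ext k l
    have h := orthonormal_iff_ite.1 b.orthonormal (g k) (g l)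
    rw [PiLp.inner_apply] at h
    simp only [Matrix.mul_apply, Matrix.transpose_apply, Matrix.of_apply, Matrix.one_apply]
    simp only [hg.eq_iff] at h
    rw [← h]
    exact Finset.sum_congr rfl fun i _ => by simp [mul_comm]
  · intro k
    exact hA.mulVec_eigenvectorBasis (g k)
  · intro w c hw hAw horth k
    by_contra! hlt
    -- A vector violating maximality is orthogonal to the whole eigenbasis: to the chosen vectors by
    -- assumption, and to the others because their eigenvalues are at most that of column `k`, hence
    -- differ from `c`.
    have key : ∀ j, inner ℝ (b j) (WithLp.toLp 2 w) = 0 := by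
      intro j
      have hin : inner ℝ (b j) (WithLp.toLp 2 w) = (b j).ofLp ⬝ᵥ w := by
        rw [PiLp.inner_apply]
        exact Finset.sum_congr rfl fun i _ => by simp [mul_comm]
      rw [hin]
      by_cases hj : j ∈ Set.range g
      · obtain ⟨l, rfl⟩ := hj
        exact horth l
      · have hle : hA.eigenvalues j ≤ hA.eigenvalues (g k) := by
          have h1 : Fin.castLE hKL k ≤ s.symm j := by
            by_contra! h2
            apply hj
            refine ⟨⟨s.symm j, lt_trans (Fin.lt_def.1 h2) k.2⟩, ?_⟩
            simp [g, Fin.castLE]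
          have h3 := hs h1
          simpa using h3
        have h1 : (A.mulVec (b j).ofLp) ⬝ᵥ w = (b j).ofLp ⬝ᵥ A.mulVec w := by
          have hT : A.transpose = A := by simpa using hA.eq
          rw [Matrix.dotProduct_mulVec, ← Matrix.mulVec_transpose, hT]
        rw [hAw, show A.mulVec (b j).ofLp = _ from hA.mulVec_eigenvectorBasis j] at h1
        simp only [smul_dotProduct, dotProduct_smul, smul_eq_mul] at h1
        have h2 : (c - hA.eigenvalues j) * ((b j).ofLp ⬝ᵥ w) = 0 := by
          change _ * ((b j).ofLp ⬝ᵥ w) = _ * ((b j).ofLp ⬝ᵥ w) at h1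
          linarith
        rcases mul_eq_zero.1 h2 with h | h
        · linarith
        · exact h
    apply hw
    have : (WithLp.toLp 2 w : EuclideanSpace ℝ (Fin L)) = 0 := by
      rw [← b.sum_repr' (WithLp.toLp 2 w)]
      simp [key]
    simpa using this

/-- On the orthogonal complement of the top eigenvectors, the quadratic form of a symmetric matrix
is bounded by each of the top eigenvalues. -/
theorem IsTopEigenvectors.exists_rayleigh_le {L K : ℕ} {A : Matrix (Fin L) (Fin L) ℝ}
    (hA : A.IsHermitian) {U : Matrix (Fin L) (Fin K) ℝ} (hU : IsTopEigenvectors A U) :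
    ∃ d : Fin K → ℝ, (∀ k, A.mulVec (fun i => U i k) = d k • (fun i => U i k)) ∧
      ∀ w : Fin L → ℝ, (∀ k, ∑ i, U i k * w i = 0) → ∀ k,
        w ⬝ᵥ A.mulVec w ≤ d k * (w ⬝ᵥ w) := by
  obtain ⟨-, d, hd, htop⟩ := hU
  refine ⟨d, hd, ?_⟩
  have hT : A.transpose = A := by simpa using hA.eq
  let T := Matrix.toEuclideanLin A
  have hTs : T.IsSymmetric := Matrix.isSymmetric_toEuclideanLin_iff.mpr hA
  -- The complement of the columns is invariant under `A`, so it has an orthonormal eigenbasis, to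
  -- which the maximality clause applies. Unlike that clause, the resulting bound on the quadratic
  -- form survives limits of matrices.
  let V : Submodule ℝ (EuclideanSpace ℝ (Fin L)) :=
    { carrier := {w | ∀ k, ∑ i, U i k * w i = 0}
      add_mem' := by
        intro x y hx hy k
        simp only [PiLp.add_apply, mul_add, Finset.sum_add_distrib]
        rw [hx k, hy k, add_zero]
      zero_mem' := by intro k; simp
      smul_mem' := by
        intro c x hx k
        simp only [PiLp.smul_apply, smul_eq_mul, mul_left_comm _ c, ← Finset.mul_sum]
        rw [hx k, mul_zero] }
  have hTV : ∀ v ∈ V, T v ∈ V := by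
    intro v hv k
    have h1 : (fun i => U i k) ⬝ᵥ A.mulVec v.ofLp = A.mulVec (fun i => U i k) ⬝ᵥ v.ofLp := by
      rw [Matrix.dotProduct_mulVec, ← Matrix.mulVec_transpose, hT]
    rw [hd k, smul_dotProduct] at h1
    have h2 : (fun i => U i k) ⬝ᵥ v.ofLp = 0 := hv k
    rw [h2, smul_zero] at h1
    exact h1
  have hS : (T.restrict hTV).IsSymmetric := hTs.restrict_invariant hTV
  intro w hw k
  let v : V := ⟨WithLp.toLp 2 w, hw⟩
  let b := hS.eigenvectorBasis rfl
  have hle : ∀ j, hS.eigenvalues rfl j ≤ d k := by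
    intro j
    have hb := hS.apply_eigenvectorBasis rfl j
    refine htop (b j : EuclideanSpace ℝ (Fin L)).ofLp _ ?_ ?_ (b j).2 k
    · have := b.orthonormal.ne_zero j
      simpa using this
    · have := congrArg (fun z : V => (z : EuclideanSpace ℝ (Fin L)).ofLp) hb
      exact this
  have h1 : inner ℝ ((T.restrict hTV) v) v = w ⬝ᵥ A.mulVec w := by
    rw [Submodule.coe_inner, PiLp.inner_apply]
    exact Finset.sum_congr rfl fun i _ => by simp [v, T, Matrix.toLpLin_apply]
  have h2 : w ⬝ᵥ w = ∑ j, inner ℝ v (b j) * inner ℝ (b j) v := by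
    rw [b.sum_inner_mul_inner, Submodule.coe_inner, PiLp.inner_apply]
    exact Finset.sum_congr rfl fun i _ => by simp [v, sq]
  rw [← h1, ← b.sum_inner_mul_inner, h2, Finset.mul_sum]
  refine Finset.sum_le_sum fun j _ => ?_
  rw [hS, show (T.restrict hTV) (b j) = _ from hS.apply_eigenvectorBasis rfl j, inner_smul_right]
  rw [real_inner_comm v (b j), mul_assoc]
  exact mul_le_mul_of_nonneg_right (hle j) (mul_self_nonneg _)

/-- If the matrix is constant on the classes of a surjective labelling, with a positive definite
reduced matrix, then the rows of the matrix of top eigenvectors are orthogonal for different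
classes, and equal within a class. -/
theorem sum_mul_rows_of_submatrix {L K : ℕ} {κ : Fin L → Fin K} (hκ : Function.Surjective κ)
    {M : Matrix (Fin K) (Fin K) ℝ} (hM : M.PosDef) {U : Matrix (Fin L) (Fin K) ℝ}
    (hU : U.transpose * U = 1) {d : Fin K → ℝ}
    (hd : ∀ k, (M.submatrix κ κ).mulVec (fun i => U i k) = d k • (fun i => U i k))
    (htop : ∀ w : Fin L → ℝ, (∀ k, ∑ i, U i k * w i = 0) → ∀ k,
        w ⬝ᵥ (M.submatrix κ κ).mulVec w ≤ d k * (w ⬝ᵥ w)) :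
    (∀ i j, κ i = κ j → U i = U j) ∧
    ∃ N : Fin K → ℝ, ∀ i j,
      (∑ k, U i k * U j k) * N (κ j) = if κ i = κ j then 1 else 0 := by
  -- With the class indicator matrix `Z`, the big matrix is `Z M Zᵀ`; its kernel is that of `Zᵀ`.
  let Z : Matrix (Fin L) (Fin K) ℝ := Matrix.of fun i t => if κ i = t then 1 else 0
  have hZA : ∀ w, (M.submatrix κ κ).mulVec w = fun i => M.mulVec (Z.transpose.mulVec w) (κ i) := by
    intro w
    ext i
    simp only [Matrix.mulVec, dotProduct, Matrix.submatrix_apply, Matrix.transpose_apply, Z,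
      Matrix.of_apply, Finset.mul_sum]
    rw [Finset.sum_comm]
    refine Finset.sum_congr rfl fun j _ => ?_
    simp
  have hZ : ∀ x : Fin K → ℝ, Z.mulVec x = fun i => x (κ i) := by
    intro x
    ext i
    simp [Matrix.mulVec, dotProduct, Z]
  have hquad : ∀ w, w ⬝ᵥ (M.submatrix κ κ).mulVec w
      = (Z.transpose.mulVec w) ⬝ᵥ M.mulVec (Z.transpose.mulVec w) := by
    intro w
    rw [hZA, ← hZ, Matrix.dotProduct_mulVec, ← Matrix.mulVec_transpose]
  have hker : ∀ w, w ⬝ᵥ (M.submatrix κ κ).mulVec w ≤ 0 → Z.transpose.mulVec w = 0 := by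
    intro w hw
    by_contra hne
    have := hM.dotProduct_mulVec_pos hne
    rw [hquad] at hw
    simp only [star_trivial] at this
    linarith
  have hUk : ∀ k, (fun i => U i k) ⬝ᵥ (fun i => U i k) = 1 := by
    intro k
    have := congrFun (congrFun hU k) k
    simpa [Matrix.mul_apply, dotProduct] using this
  -- If `d k ≤ 0`, column `k` is killed by `Zᵀ`, so the square matrix `Uᵀ Z` is singular. A null
  -- vector `x` gives `Z x` orthogonal to all columns, so its quadratic form is at most `0`, forcing
  -- `Zᵀ Z x = 0` and finally `x = 0`.
  have hdpos : ∀ k, 0 < d k := by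
    intro k
    by_contra! hk
    have hk0 : Z.transpose.mulVec (fun i => U i k) = 0 := by
      apply hker
      rw [hd, dotProduct_smul, hUk]
      simpa using hk
    have hdet : (U.transpose * Z).det = 0 := by
      apply Matrix.det_eq_zero_of_row_eq_zero k
      intro t
      have := congrFun hk0 t
      simp only [Matrix.mulVec, dotProduct, Matrix.transpose_apply, Pi.zero_apply] at this
      simp only [Matrix.mul_apply, Matrix.transpose_apply]
      rw [← this]
      exact Finset.sum_congr rfl fun i _ => mul_comm _ _
    obtain ⟨x, hx, hx0⟩ := Matrix.exists_mulVec_eq_zero_iff.2 hdet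
    have horth : ∀ l, ∑ i, U i l * Z.mulVec x i = 0 := by
      intro l
      have := congrFun hx0 l
      rw [← Matrix.mulVec_mulVec] at this
      simpa [Matrix.mulVec, dotProduct] using this
    have h0 : Z.transpose.mulVec (Z.mulVec x) = 0 := by
      apply hker
      refine (htop _ horth k).trans (mul_nonpos_of_nonpos_of_nonneg hk ?_)
      exact Finset.sum_nonneg fun i _ => mul_self_nonneg _
    have h1 : Z.mulVec x ⬝ᵥ Z.mulVec x = 0 := by
      rw [Matrix.dotProduct_mulVec, ← Matrix.mulVec_transpose, h0, zero_dotProduct]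
    have h2 := dotProduct_self_eq_zero.1 h1
    apply hx
    ext t
    obtain ⟨i, rfl⟩ := hκ t
    simpa [hZ] using congrFun h2 i
  -- Dividing the eigenvector equation by `d k` expresses `U` as `Z * Q`. Then `Uᵀ U = 1` reads `Qᵀ
  -- (Zᵀ Z) Q = 1`, and since `Q` is square the factors commute, which gives the row relations with
  -- `N` the class sizes.
  let Q : Matrix (Fin K) (Fin K) ℝ := Matrix.of fun t k =>
    (d k)⁻¹ * M.mulVec (Z.transpose.mulVec (fun i => U i k)) t
  have hUQ : ∀ i k, U i k = Q (κ i) k := by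
    intro i k
    have h := congrFun ((hZA _).symm.trans (hd k)) i
    simp only [Pi.smul_apply, smul_eq_mul] at h
    simp only [Q, Matrix.of_apply]
    rw [h, inv_mul_cancel_left₀ (hdpos k).ne']
  have hUZQ : U = Z * Q := by
    ext i k
    rw [hUQ]
    simp [Matrix.mul_apply, Z]
  refine ⟨fun i j h => by ext k; rw [hUQ, hUQ, h], fun t => ∑ i, if κ i = t then 1 else 0, ?_⟩
  have hZZ : Z.transpose * Z = Matrix.diagonal fun t => ∑ i, if κ i = t then 1 else 0 := by
    ext s t
    simp only [Matrix.mul_apply, Matrix.transpose_apply, Z, Matrix.of_apply, Matrix.diagonal_apply]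
    split_ifs with h
    · subst h
      exact Finset.sum_congr rfl fun i _ => by split_ifs <;> simp
    · refine Finset.sum_eq_zero fun i _ => ?_
      by_cases h1 : κ i = s
      · have : κ i ≠ t := fun h2 => h (h1.symm.trans h2)
        simp [this]
      · simp [h1]
  have hQ : Q * (Q.transpose * Matrix.diagonal fun t => ∑ i, if κ i = t then 1 else 0) = 1 := by
    rw [mul_eq_one_comm, ← hZZ, ← hU, hUZQ, Matrix.transpose_mul]
    simp only [Matrix.mul_assoc]
  intro i j
  have h := congrFun (congrFun hQ (κ i)) (κ j)
  rw [← Matrix.mul_assoc, Matrix.mul_diagonal, Matrix.mul_apply, Matrix.one_apply] at h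
  rw [← h]
  simp only [hUQ, Matrix.transpose_apply]

/-- The diagonal relation excludes zero rows; equal unit rows of different classes would be
orthogonal to themselves. -/
theorem unitRow_eq_iff_of_sum_mul_rows {L K : ℕ} {κ : Fin L → Fin K} {U : Matrix (Fin L) (Fin K) ℝ}
    (heq : ∀ i j, κ i = κ j → U i = U j) {N : Fin K → ℝ}
    (hN : ∀ i j, (∑ k, U i k * U j k) * N (κ j) = if κ i = κ j then 1 else 0) (i j : Fin L) :
    (WithLp.toLp 2 (U i) : EuclideanSpace ℝ (Fin K)) ≠ 0 ∧
      (unitRow U i = unitRow U j ↔ κ i = κ j) := by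
  have hne : ∀ i, (WithLp.toLp 2 (U i) : EuclideanSpace ℝ (Fin K)) ≠ 0 := by
    intro i h
    have h1 : U i = 0 := by simpa using h
    have := hN i i
    simp [h1] at this
  refine ⟨hne i, fun h => ?_, fun h => by simp only [unitRow, heq i j h]⟩
  by_contra hij
  have h0 : inner ℝ (WithLp.toLp 2 (U i) : EuclideanSpace ℝ (Fin K)) (WithLp.toLp 2 (U j)) = 0 := by
    have h1 := hN i j
    have h2 := hN j j
    rw [if_neg hij] at h1
    rw [if_pos rfl] at h2
    have h3 : N (κ j) ≠ 0 := by
      rintro h3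
      simp [h3] at h2
    rw [PiLp.inner_apply, ← (mul_eq_zero.1 h1).resolve_right h3]
    exact Finset.sum_congr rfl fun k _ => by simp [mul_comm]
  have h1 : inner ℝ (unitRow U i) (unitRow U j) = 0 := by
    simp only [unitRow, real_inner_smul_left, real_inner_smul_right, h0, mul_zero]
  rw [← h, inner_self_eq_zero] at h1
  simp only [unitRow, smul_eq_zero, inv_eq_zero, norm_eq_zero, or_self] at h1
  exact hne i h1

/-! ### The `k`-means objective and stability of spectral clustering. -/

theorem continuous_kmeansCost {L K : ℕ} (c : Fin L → Fin K) :
    Continuous fun u : Fin L → EuclideanSpace ℝ (Fin K) => kmeansCost u c := by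
  unfold kmeansCost
  fun_prop

theorem kmeansCost_eq_zero_of_eq {L K : ℕ} {u : Fin L → EuclideanSpace ℝ (Fin K)}
    {c : Fin L → Fin K} (h : ∀ i j, c i = c j → u i = u j) : kmeansCost u c = 0 := by
  refine Finset.sum_eq_zero fun t _ => ?_
  rw [Finset.sum_eq_zero, zero_div]
  intro i hi
  refine Finset.sum_eq_zero fun j hj => ?_
  simp only [Finset.mem_filter, Finset.mem_univ, true_and] at hi hj
  simp [h i j (hi.trans hj.symm)]

theorem eq_of_kmeansCost_nonpos {L K : ℕ} {u : Fin L → EuclideanSpace ℝ (Fin K)}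
    {c : Fin L → Fin K} (h : kmeansCost u c ≤ 0) {i j : Fin L} (hij : c i = c j) : u i = u j := by
  have hin : ∀ t, 0 ≤ ∑ i with c i = t, ∑ j with c j = t, ‖u i - u j‖ ^ 2 := fun t =>
    Finset.sum_nonneg fun i _ => Finset.sum_nonneg fun j _ => sq_nonneg _
  have hnn : ∀ t ∈ Finset.univ, 0 ≤ (∑ i with c i = t, ∑ j with c j = t, ‖u i - u j‖ ^ 2) /
      (2 * ((Finset.univ.filter fun i => c i = t).card : ℝ)) := fun t _ =>
    div_nonneg (hin t) (by positivity)
  have h0 := (Finset.sum_eq_zero_iff_of_nonneg hnn).1 (le_antisymm h (Finset.sum_nonneg hnn))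
    (c i) (Finset.mem_univ _)
  have hcard : (0 : ℝ) < 2 * ((Finset.univ.filter fun i' => c i' = c i).card : ℝ) := by
    have : 0 < (Finset.univ.filter fun i' => c i' = c i).card :=
      Finset.card_pos.2 ⟨i, by simp⟩
    positivity
  rw [div_eq_zero_iff, or_iff_left hcard.ne'] at h0
  rw [Finset.sum_eq_zero_iff_of_nonneg
    fun i _ => Finset.sum_nonneg fun j _ => sq_nonneg _] at h0
  have h1 := h0 i (by simp)
  rw [Finset.sum_eq_zero_iff_of_nonneg fun j _ => sq_nonneg _] at h1
  have h2 := h1 j (by simp [hij])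
  simpa [sub_eq_zero] using h2

/-- Pigeonhole: representatives of the `K` classes already use up all `K` labels, so no class can be
split. -/
theorem label_iff_of_refines {L K : ℕ} {κ c : Fin L → Fin K} (hκ : Function.Surjective κ)
    (h : ∀ i j, c i = c j → κ i = κ j) (i j : Fin L) : c i = c j ↔ κ i = κ j := by
  refine ⟨h i j, fun hij => ?_⟩
  choose s hs using hκ
  have hinj : Function.Injective (c ∘ s) := by
    intro t t' htt
    have := h _ _ htt
    rwa [hs, hs] at this
  have hsurj := Finite.surjective_of_injective hinj
  obtain ⟨t, ht⟩ := hsurj (c i)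
  obtain ⟨t', ht'⟩ := hsurj (c j)
  have h1 := h _ _ ht
  have h2 := h _ _ ht'
  rw [hs] at h1 h2
  rw [← ht, ← ht', h1, h2, hij]

/-- Spectral clustering recovers the classes from all symmetric matrices close to a matrix which is
constant on the classes, with a positive definite reduced matrix. -/
theorem eventually_isKMeans_label_iff {L K : ℕ} {κ : Fin L → Fin K} (hκ : Function.Surjective κ)
    {M : Matrix (Fin K) (Fin K) ℝ} (hM : M.PosDef) :
    ∀ᶠ A in 𝓝 (M.submatrix κ κ), A.IsHermitian → ∀ (U : Matrix (Fin L) (Fin K) ℝ)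
      (c : Fin L → Fin K), IsTopEigenvectors A U → IsKMeans (unitRow U) c →
      ∀ i j, c i = c j ↔ κ i = κ j := by
  -- There are finitely many labellings, so `c` may be fixed; it then stays constant along the
  -- sequence of counterexamples.
  suffices h : ∀ c : Fin L → Fin K, ∀ᶠ A in 𝓝 (M.submatrix κ κ), A.IsHermitian →
      ∀ U : Matrix (Fin L) (Fin K) ℝ, IsTopEigenvectors A U → IsKMeans (unitRow U) c →
      ∀ i j, c i = c j ↔ κ i = κ j by
    filter_upwards [Filter.eventually_all.2 h] with A hA hAh U c
    exact hA c hAh U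
  intro c
  by_contra hnot
  have : FirstCountableTopology (Matrix (Fin L) (Fin L) ℝ) :=
    inferInstanceAs (FirstCountableTopology (Fin L → Fin L → ℝ))
  obtain ⟨A, hAlim, hA⟩ := Filter.exists_seq_forall_of_frequently (Filter.not_eventually.1 hnot)
  push Not at hA
  choose hAh U hU hkm hbad using hA
  have hbound : ∀ m, U m ∈ Set.univ.pi fun _ : Fin L => Set.univ.pi fun _ : Fin K =>
      Set.Icc (-1 : ℝ) 1 := by
    intro m i _ k _
    have h1 := congrFun (congrFun (hU m).1 k) k
    simp only [Matrix.mul_apply, Matrix.transpose_apply, Matrix.one_apply_eq] at h1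
    have h2 : U m i k * U m i k ≤ 1 := by
      rw [← h1]
      exact Finset.single_le_sum (f := fun i => U m i k * U m i k)
        (fun i _ => mul_self_nonneg _) (Finset.mem_univ i)
    exact abs_le.1 (abs_le_of_sq_le_sq' (by nlinarith) zero_le_one |> abs_le.2)
  have hcpt : IsCompact (Set.univ.pi fun _ : Fin L => Set.univ.pi fun _ : Fin K =>
      Set.Icc (-1 : ℝ) 1) :=
    isCompact_univ_pi fun _ => isCompact_univ_pi fun _ => isCompact_Icc
  obtain ⟨(V : Matrix (Fin L) (Fin K) ℝ), -, φ, hφ, hlim⟩ := hcpt.tendsto_subseq hbound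
  change Tendsto (fun m => U (φ m)) atTop (𝓝 V) at hlim
  have hUik : ∀ i k, Tendsto (fun m => U (φ m) i k) atTop (𝓝 (V i k)) := fun i k =>
    (tendsto_pi_nhds.1 ((tendsto_pi_nhds.1 hlim) i)) k
  have hAφ : Tendsto (fun m => A (φ m)) atTop (𝓝 (M.submatrix κ κ)) := hAlim.comp hφ.tendsto_atTop
  have hcol : ∀ k, Tendsto (fun m i => U (φ m) i k) atTop (𝓝 fun i => V i k) := fun k =>
    tendsto_pi_nhds.2 fun i => hUik i k
  choose d hd htop using fun m => (hU m).exists_rayleigh_le (hAh m)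
  have horth : Matrix.transpose V * V = 1 := by
    refine tendsto_nhds_unique (f := fun m => (U (φ m)).transpose * U (φ m)) (l := atTop) ?_ ?_
    · have : Continuous fun W : Matrix (Fin L) (Fin K) ℝ => W.transpose * W := by fun_prop
      exact (this.tendsto V).comp hlim
    · simp only [(hU _).1]
      exact tendsto_const_nhds
  have hmulVec : ∀ {w : ℕ → Fin L → ℝ} {w' : Fin L → ℝ}, Tendsto w atTop (𝓝 w') →
      Tendsto (fun m => (A (φ m)).mulVec (w m)) atTop (𝓝 ((M.submatrix κ κ).mulVec w')) := by
    intro w w' hw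
    have : Continuous fun q : Matrix (Fin L) (Fin L) ℝ × (Fin L → ℝ) => q.1.mulVec q.2 := by
      fun_prop
    exact (this.tendsto (_, _)).comp (hAφ.prodMk_nhds hw)
  have hdot : ∀ {w z : ℕ → Fin L → ℝ} {w' z' : Fin L → ℝ}, Tendsto w atTop (𝓝 w') →
      Tendsto z atTop (𝓝 z') → Tendsto (fun m => w m ⬝ᵥ z m) atTop (𝓝 (w' ⬝ᵥ z')) := by
    intro w z w' z' hw hz
    have : Continuous fun q : (Fin L → ℝ) × (Fin L → ℝ) => q.1 ⬝ᵥ q.2 := by fun_prop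
    exact (this.tendsto (_, _)).comp (hw.prodMk_nhds hz)
  -- Each eigenvalue is the Rayleigh quotient of its unit column, so it converges along the
  -- subsequence.
  have hdk : ∀ k, Tendsto (fun m => d (φ m) k) atTop
      (𝓝 ((fun i => V i k) ⬝ᵥ (M.submatrix κ κ).mulVec fun i => V i k)) := by
    intro k
    refine (hdot (hcol k) (hmulVec (hcol k))).congr fun m => ?_
    rw [hd]
    have h1 := congrFun (congrFun (hU (φ m)).1 k) k
    simp only [Matrix.mul_apply, Matrix.transpose_apply, Matrix.one_apply_eq] at h1
    rw [dotProduct_smul, dotProduct, h1, smul_eq_mul, mul_one]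
  obtain ⟨hrows, N, hN⟩ := sum_mul_rows_of_submatrix hκ hM horth
    (d := fun k => (fun i => V i k) ⬝ᵥ (M.submatrix κ κ).mulVec fun i => V i k)
    (fun k => by
      refine tendsto_nhds_unique (hmulVec (hcol k)) ?_
      simp only [hd]
      exact (hdk k).smul (hcol k))
    (fun w hw k => by
      -- A test vector orthogonal to the limit columns is projected off the columns of `U (φ m)`;
      -- the projections are admissible at stage `m` and converge to `w`.
      have hP : Tendsto (fun m => w - (U (φ m)).mulVec ((U (φ m)).transpose.mulVec w)) atTop
          (𝓝 w) := by
        have hc : Continuous fun W : Matrix (Fin L) (Fin K) ℝ =>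
          w - W.mulVec (W.transpose.mulVec w) := by fun_prop
        have h0 : (Matrix.transpose V).mulVec w = 0 := funext hw
        have h1 := (hc.tendsto V).comp hlim
        simpa [h0, Function.comp_def] using h1
      refine le_of_tendsto_of_tendsto' (hdot hP (hmulVec hP)) ((hdk k).mul (hdot hP hP))
        fun m => htop (φ m) _ (fun l => ?_) k
      have : (U (φ m)).transpose.mulVec
          (w - (U (φ m)).mulVec ((U (φ m)).transpose.mulVec w)) = 0 := by
        rw [Matrix.mulVec_sub, Matrix.mulVec_mulVec, (hU _).1, Matrix.one_mulVec, sub_self]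
      exact congrFun this l)
  have hrow := unitRow_eq_iff_of_sum_mul_rows hrows hN
  have hunit : Tendsto (fun m => unitRow (U (φ m))) atTop (𝓝 (unitRow V)) := by
    refine tendsto_pi_nhds.2 fun i => ?_
    have h1 : Tendsto (fun m => (WithLp.toLp 2 (U (φ m) i) : EuclideanSpace ℝ (Fin K))) atTop
        (𝓝 (WithLp.toLp 2 (V i))) :=
      ((PiLp.continuous_toLp 2 _).tendsto _).comp (tendsto_pi_nhds.1 hlim i)
    exact (h1.norm.inv₀ (norm_ne_zero_iff.2 (hrow i i).1)).smul h1
  -- The true labelling `κ` is a competitor all along the sequence, and its cost vanishes in the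
  -- limit.
  have hcost : kmeansCost (unitRow V) c ≤ 0 := by
    rw [← kmeansCost_eq_zero_of_eq fun i j h => (hrow i j).2.2 h]
    exact le_of_tendsto_of_tendsto' (((continuous_kmeansCost c).tendsto _).comp hunit)
      (((continuous_kmeansCost κ).tendsto _).comp hunit) fun m => hkm (φ m) κ
  obtain ⟨i, j, hij⟩ := hbad 0
  have := label_iff_of_refines hκ
    (fun i j h => (hrow i j).2.1 (eq_of_kmeansCost_nonpos hcost h)) i j
  tauto

/-! ### The normalized similarity matrix and the Gaussian kernel. -/

theorem continuous_laplacian_similarity {L : ℕ} (a : ℝ) :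
    Continuous fun v : Fin L → Fin L → ℝ => laplacian (similarity a v) := by
  have h1 : ∀ i, Continuous fun v : Fin L → Fin L → ℝ =>
      (Real.sqrt (∑ j, similarity a v i j))⁻¹ := by
    intro i
    refine Continuous.inv₀ ?_ fun v => ?_
    · simp only [similarity, Matrix.of_apply]
      fun_prop
    · refine (Real.sqrt_pos.2 (Finset.sum_pos (fun j _ => Real.exp_pos _) ⟨i, by simp⟩)).ne'
  have h2 : Continuous fun v : Fin L → Fin L → ℝ => similarity a v := by
    refine continuous_matrix fun i j => ?_
    simp only [similarity, Matrix.of_apply]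
    fun_prop
  unfold laplacian
  have h3 := (continuous_pi h1).matrix_diagonal
  exact (h3.matrix_mul h2).matrix_mul h3

theorem laplacian_apply {L : ℕ} (S : Matrix (Fin L) (Fin L) ℝ) (i j : Fin L) :
    laplacian S i j = (Real.sqrt (∑ l, S i l))⁻¹ * S i j * (Real.sqrt (∑ l, S j l))⁻¹ := by
  rw [laplacian, Matrix.mul_diagonal, Matrix.diagonal_mul]

theorem isHermitian_laplacian_similarity {L : ℕ} (a : ℝ) {v : Fin L → Fin L → ℝ}
    (hv : ∀ i j, v i j = v j i) : (laplacian (similarity a v)).IsHermitian := by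
  ext i j
  rw [Matrix.conjTranspose_apply, star_trivial, laplacian_apply, laplacian_apply,
    show similarity a v i j = similarity a v j i by simp [similarity, hv i j]]
  ring

/-- The Gaussian kernel of distinct points is strictly positive definite. -/
theorem posDef_gaussianKernel {ι E : Type*} [Fintype ι] [NormedAddCommGroup E]
    [InnerProductSpace ℝ E] {b : ℝ} (hb : 0 < b) {x : ι → E} (hx : Function.Injective x) :
    (Matrix.of fun k l => Real.exp (-b * ‖x k - x l‖ ^ 2)).PosDef := by
  classical
  have hpow : ∀ n : ℕ, (Matrix.of fun k l => (inner ℝ (x k) (x l)) ^ n :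
      Matrix ι ι ℝ).PosSemidef := by
    intro n
    induction n with
    | zero =>
      have h := Matrix.posSemidef_gram ℝ (n := ι) (fun _ => (1 : ℝ))
      rwa [show (Matrix.of fun k l => (inner ℝ (x k) (x l)) ^ 0 : Matrix ι ι ℝ)
        = Matrix.gram ℝ (fun _ : ι => (1 : ℝ)) by ext k l; simp [Matrix.gram]]
    | succ n ih =>
      have h := ih.hadamard (Matrix.posSemidef_gram ℝ x)
      rwa [show (Matrix.of fun k l => (inner ℝ (x k) (x l)) ^ (n + 1) : Matrix ι ι ℝ)
        = (Matrix.of fun k l => (inner ℝ (x k) (x l)) ^ n : Matrix ι ι ℝ).hadamard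
          (Matrix.gram ℝ x) by ext k l; simp [Matrix.gram, pow_succ]]
  refine Matrix.PosDef.of_dotProduct_mulVec_pos ?_ fun c hc => ?_
  · ext k l
    simp [norm_sub_rev]
  -- Absorbing the factors `exp (-b ‖x k‖²)` into the vector leaves the kernel `exp (2 b ⟪x, y⟫)`,
  -- whose power series has positive semidefinite terms by the Schur product theorem.
  let e : ι → ℝ := fun k => Real.exp (-b * ‖x k‖ ^ 2) * c k
  let q : ℕ → ℝ := fun n => ∑ k, ∑ l, e k * e l * inner ℝ (x k) (x l) ^ n
  have hq : ∀ n, q n = e ⬝ᵥ (Matrix.of fun k l => (inner ℝ (x k) (x l)) ^ n :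
      Matrix ι ι ℝ).mulVec e := by
    intro n
    simp only [q, dotProduct, Matrix.mulVec, Matrix.of_apply, Finset.mul_sum]
    exact Finset.sum_congr rfl fun k _ => Finset.sum_congr rfl fun l _ => by ring
  have hq0 : ∀ n, 0 ≤ q n := by
    intro n
    rw [hq]
    simpa using (hpow n).dotProduct_mulVec_nonneg e
  have hsum : HasSum (fun n : ℕ => (2 * b) ^ n / n.factorial * q n) (star c ⬝ᵥ
      (Matrix.of fun k l => Real.exp (-b * ‖x k - x l‖ ^ 2)).mulVec c) := by
    have h1 : ∀ k l, HasSum (fun n : ℕ => (2 * b) ^ n / n.factorial *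
        (e k * e l * inner ℝ (x k) (x l) ^ n))
        (c k * (Real.exp (-b * ‖x k - x l‖ ^ 2) * c l)) := by
      intro k l
      have h2 := (NormedSpace.expSeries_div_hasSum_exp (2 * b * inner ℝ (x k) (x l))).mul_left
        (e k * e l)
      rw [← Real.exp_eq_exp_ℝ] at h2
      convert! h2 using 1
      · ext n
        rw [mul_pow]
        ring
      · rw [norm_sub_sq_real, show -b * (‖x k‖ ^ 2 - 2 * inner ℝ (x k) (x l) + ‖x l‖ ^ 2) =
          -b * ‖x k‖ ^ 2 + -b * ‖x l‖ ^ 2 + 2 * b * inner ℝ (x k) (x l) by ring, Real.exp_add,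
          Real.exp_add]
        simp only [e]
        ring
    have h3 := hasSum_sum fun k (_ : k ∈ Finset.univ) =>
      hasSum_sum fun l (_ : l ∈ Finset.univ) => h1 k l
    convert! h3 using 1
    · ext n
      simp only [q, Finset.mul_sum]
    · simp [dotProduct, Matrix.mulVec, Finset.mul_sum]
  have hterm : ∀ n : ℕ, 0 ≤ (2 * b) ^ n / n.factorial * q n := fun n =>
    mul_nonneg (by positivity) (hq0 n)
  refine lt_of_le_of_ne (hsum.nonneg hterm) fun h0 => ?_
  rw [← h0, hasSum_zero_iff_of_nonneg hterm] at hsum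
  have hqz : ∀ n, q n = 0 := by
    intro n
    have := congrFun hsum n
    exact (mul_eq_zero.1 this).resolve_left (by positivity)
  have hvec : ∀ n k, ∑ l, inner ℝ (x k) (x l) ^ n * e l = 0 := by
    intro n k
    have h1 := ((hpow n).dotProduct_mulVec_zero_iff e).1 (by rw [star_trivial, ← hq, hqz])
    simpa [Matrix.mulVec, dotProduct] using congrFun h1 k
  have hpoly : ∀ (P : Polynomial ℝ) k, ∑ l, P.eval (inner ℝ (x k) (x l)) * e l = 0 := by
    intro P k
    simp only [Polynomial.eval_eq_sum_range, Finset.sum_mul]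
    rw [Finset.sum_comm]
    refine Finset.sum_eq_zero fun n _ => ?_
    simp only [mul_assoc, ← Finset.mul_sum, hvec, mul_zero]
  have hne : (Finset.univ.filter fun k => e k ≠ 0).Nonempty := by
    obtain ⟨k, hk⟩ := Function.ne_iff.1 hc
    exact ⟨k, by simpa [e] using hk⟩
  -- For a point of largest norm in the support of `e`, `⟪x k, x l⟫ = ‖x k‖²` forces `x l = x k`.
  -- Hence a polynomial vanishing at the other inner products is nonzero at `‖x k‖²`, and isolates
  -- `e k`.
  obtain ⟨k, hk, hmax⟩ := Finset.exists_max_image _ (fun k => ‖x k‖) hne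
  simp only [Finset.mem_filter, Finset.mem_univ, true_and] at hk hmax
  let P : Polynomial ℝ := ∏ l ∈ Finset.univ.filter fun l => e l ≠ 0 ∧ l ≠ k,
    (Polynomial.X - Polynomial.C (inner ℝ (x k) (x l)))
  have hP := hpoly P k
  rw [Finset.sum_eq_single k] at hP
  · rcases mul_eq_zero.1 hP with h | h
    · simp only [P, Polynomial.eval_prod, Finset.prod_eq_zero_iff, Finset.mem_filter,
        Finset.mem_univ, true_and, Polynomial.eval_sub, Polynomial.eval_X, Polynomial.eval_C,
        sub_eq_zero] at h
      obtain ⟨l, ⟨hl, hlk⟩, h⟩ := h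
      apply hlk
      apply hx
      rw [← sub_eq_zero, ← norm_eq_zero, ← sq_eq_zero_iff]
      refine le_antisymm ?_ (sq_nonneg _)
      rw [norm_sub_sq_real, real_inner_comm, ← h, real_inner_self_eq_norm_sq]
      have := pow_le_pow_left₀ (norm_nonneg _) (hmax l hl) 2
      linarith
    · exact hk h
  · intro l _ hlk
    by_cases hl : e l = 0
    · rw [hl, mul_zero]
    · rw [show P.eval (inner ℝ (x k) (x l)) = 0 from ?_, zero_mul]
      simp only [P, Polynomial.eval_prod]
      exact Finset.prod_eq_zero (i := l) (by simp [hl, hlk]) (by simp)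
  · simp

/-- If the dissimilarities are close to the squared distances (up to a factor) of the points
attached to the classes, then spectral clustering recovers the classes. -/
theorem eventually_label_iff_of_sqDist {L K : ℕ} {κ : Fin L → Fin K} (hκ : Function.Surjective κ)
    {E : Type*} [NormedAddCommGroup E] [InnerProductSpace ℝ E] {x : Fin K → E}
    (hx : Function.Injective x) {a b : ℝ} (ha : 0 < a) (hb : 0 < b) :
    ∀ᶠ v in 𝓝 (fun i j => b * ‖x (κ i) - x (κ j)‖ ^ 2 : Fin L → Fin L → ℝ),
      (∀ i j, v i j = v j i) → ∀ (U : Matrix (Fin L) (Fin K) ℝ)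
      (c : Fin L → Fin K), IsTopEigenvectors (laplacian (similarity a v)) U →
      IsKMeans (unitRow U) c → ∀ i j, c i = c j ↔ κ i = κ j := by
  let B : Matrix (Fin K) (Fin K) ℝ := Matrix.of fun k l => Real.exp (-(a * b) * ‖x k - x l‖ ^ 2)
  have hB : B.PosDef := posDef_gaussianKernel (mul_pos ha hb) hx
  -- The sum runs over learners, not classes, so the normalization carries the class sizes.
  let r : Fin K → ℝ := fun k => (Real.sqrt (∑ l, B k (κ l)))⁻¹
  have hr : ∀ k, 0 < r k := fun k => by
    obtain ⟨i, rfl⟩ := hκ k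
    exact inv_pos.2 (Real.sqrt_pos.2
      (Finset.sum_pos (fun l _ => Real.exp_pos _) ⟨i, Finset.mem_univ _⟩))
  let M : Matrix (Fin K) (Fin K) ℝ := Matrix.diagonal r * B * Matrix.diagonal r
  have hM : M.PosDef := by
    refine Matrix.PosDef.of_dotProduct_mulVec_pos ?_ fun c hc => ?_
    · ext k l
      simp only [M, Matrix.conjTranspose_apply, Matrix.mul_diagonal, Matrix.diagonal_mul, B,
        Matrix.of_apply, norm_sub_rev (x l), star_trivial]
      ring
    · have h : star c ⬝ᵥ M.mulVec c = star (fun k => r k * c k) ⬝ᵥ B.mulVec (fun k => r k * c k) := by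
        simp only [dotProduct, Matrix.mulVec, M, Matrix.mul_diagonal, Matrix.diagonal_mul,
          Finset.mul_sum, star_trivial]
        exact Finset.sum_congr rfl fun k _ => Finset.sum_congr rfl fun l _ => by ring
      rw [h]
      refine hB.dotProduct_mulVec_pos fun h0 => hc ?_
      ext k
      exact (mul_eq_zero.1 (congrFun h0 k)).resolve_left (hr k).ne'
  have hlap : laplacian (similarity a fun i j => b * ‖x (κ i) - x (κ j)‖ ^ 2)
      = M.submatrix κ κ := by
    have hs : ∀ i j, similarity a (fun i j => b * ‖x (κ i) - x (κ j)‖ ^ 2) i j = B (κ i) (κ j) := by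
      intro i j
      simp only [similarity, B, Matrix.of_apply]
      ring_nf
    ext i j
    rw [laplacian_apply]
    simp only [hs, M, r, Matrix.submatrix_apply, Matrix.mul_diagonal, Matrix.diagonal_mul]
  have hcont := (continuous_laplacian_similarity (L := L) a).tendsto
    (fun i j => b * ‖x (κ i) - x (κ j)‖ ^ 2)
  rw [hlap] at hcont
  filter_upwards [hcont.eventually (eventually_isKMeans_label_iff hκ hM)] with v hv hsymm
  exact hv (isHermitian_laplacian_similarity a hsymm)

/-! ### Independence and conditioning. -/

section Independence

variable {Ω : Type*} [MeasurableSpace Ω] {μ : Measure Ω}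

/-- Restrictions of an independent family to disjoint finite sets of indices are independent. -/
theorem indepFun_of_disjoint_range {ι α β 𝒳 : Type*} [Finite α] [Finite β]
    [MeasurableSpace 𝒳] {X : ι → Ω → 𝒳} (hX : iIndepFun X μ) (hXm : ∀ i, Measurable (X i))
    (e : α → ι) (e' : β → ι) (he : ∀ s t, e s ≠ e' t) :
    IndepFun (fun ω s => X (e s) ω) (fun ω t => X (e' t) ω) μ := by
  classical
  have := Fintype.ofFinite α
  have := Fintype.ofFinite β
  have h := hX.indepFun_finset (Finset.univ.image e) (Finset.univ.image e')
    (by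
      rw [Finset.disjoint_left]
      intro i hi hi'
      simp only [Finset.mem_image, Finset.mem_univ, true_and] at hi hi'
      obtain ⟨s, rfl⟩ := hi
      obtain ⟨t, ht⟩ := hi'
      exact he s t ht.symm) hXm
  exact h.comp
    (φ := fun x s => x ⟨e s, Finset.mem_image_of_mem _ (Finset.mem_univ _)⟩)
    (ψ := fun x t => x ⟨e' t, Finset.mem_image_of_mem _ (Finset.mem_univ _)⟩)
    (by fun_prop) (by fun_prop)

variable [IsProbabilityMeasure μ]

/-- The joint law of all four variables is a product, so they can be regrouped by Tonelli. Later
uses put a constant in a slot that is not needed. -/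
theorem indepFun_prodMk_prodMk {𝒜 𝒜' ℬ ℬ' : Type*} [MeasurableSpace 𝒜] [MeasurableSpace 𝒜']
    [MeasurableSpace ℬ] [MeasurableSpace ℬ'] {A : Ω → 𝒜} {A' : Ω → 𝒜'} {B : Ω → ℬ} {B' : Ω → ℬ'}
    (hA : Measurable A) (hA' : Measurable A') (hB : Measurable B) (hB' : Measurable B')
    (hAA : IndepFun A A' μ) (hBB : IndepFun B B' μ)
    (hAB : IndepFun (fun ω => (A ω, A' ω)) (fun ω => (B ω, B' ω)) μ) :
    IndepFun (fun ω => (A ω, B ω)) (fun ω => (A' ω, B' ω)) μ := by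
  have h1 : IndepFun A B μ := hAB.comp measurable_fst measurable_fst
  have h2 : IndepFun A' B' μ := hAB.comp measurable_snd measurable_snd
  have := Measure.isProbabilityMeasure_map (μ := μ) hA.aemeasurable
  have := Measure.isProbabilityMeasure_map (μ := μ) hA'.aemeasurable
  have := Measure.isProbabilityMeasure_map (μ := μ) hB.aemeasurable
  have := Measure.isProbabilityMeasure_map (μ := μ) hB'.aemeasurable
  rw [indepFun_iff_map_prod_eq_prod_map_map (by fun_prop) (by fun_prop)] at hAA hBB hAB h1 h2 ⊢
  rw [hAA, hBB] at hAB
  rw [h1, h2]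
  refine Measure.ext_of_lintegral _ fun f hf => ?_
  have e1 : ∫⁻ z, f z ∂(μ.map fun ω => ((A ω, B ω), (A' ω, B' ω)))
      = ∫⁻ z, f ((z.1.1, z.2.1), (z.1.2, z.2.2))
        ∂(μ.map fun ω => ((A ω, A' ω), (B ω, B' ω))) := by
    rw [lintegral_map hf (by fun_prop), lintegral_map (by fun_prop) (by fun_prop)]
  rw [e1, hAB, lintegral_prod _ (by fun_prop), lintegral_prod _ (by fun_prop),
    lintegral_prod _ (by fun_prop), lintegral_prod _ (by fun_prop)]
  refine lintegral_congr fun x => ?_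
  have e2 : ∀ y : 𝒜', ∫⁻ z, f ((x, z.1), (y, z.2)) ∂((μ.map B).prod (μ.map B'))
      = ∫⁻ b, ∫⁻ b', f ((x, b), (y, b')) ∂(μ.map B') ∂(μ.map B) := fun y =>
    lintegral_prod _ (by fun_prop)
  have e3 : ∀ b : ℬ, ∫⁻ z, f ((x, b), z) ∂((μ.map A').prod (μ.map B'))
      = ∫⁻ y, ∫⁻ b', f ((x, b), (y, b')) ∂(μ.map B') ∂(μ.map A') := fun b =>
    lintegral_prod _ (by fun_prop)
  simp only [e2, e3]
  refine lintegral_lintegral_swap (Measurable.aemeasurable ?_)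
  exact Measurable.lintegral_prod_right'
    (f := fun q : (𝒜' × ℬ) × ℬ' => f ((x, q.1.2), (q.1.1, q.2))) (by fun_prop)

/-- Conditioning on `Z`: the conditional probability is at most `b` on `G` and at most `1`
elsewhere. `G` need not be measurable, as the measurable set where the bound fails replaces its
complement. -/
theorem measure_prodMk_mem_le {𝒵 𝒲 : Type*} [MeasurableSpace 𝒵] [MeasurableSpace 𝒲]
    {Z : Ω → 𝒵} {W : Ω → 𝒲} (hZ : Measurable Z) (hW : Measurable W) (hZW : IndepFun Z W μ)
    {E : Set (𝒵 × 𝒲)} (hE : MeasurableSet E) {G : Set 𝒵} {b : ℝ≥0∞}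
    (h : ∀ z ∈ G, μ {ω | (z, W ω) ∈ E} ≤ b) :
    μ {ω | (Z ω, W ω) ∈ E} ≤ μ {ω | Z ω ∉ G} + b := by
  have := Measure.isProbabilityMeasure_map (μ := μ) hZ.aemeasurable
  have := Measure.isProbabilityMeasure_map (μ := μ) hW.aemeasurable
  let φ : 𝒵 → ℝ≥0∞ := fun z => μ.map W (Prod.mk z ⁻¹' E)
  have hφ : Measurable φ := measurable_measure_prodMk_left hE
  have hφeq : ∀ z, φ z = μ {ω | (z, W ω) ∈ E} := fun z =>
    Measure.map_apply hW (measurable_prodMk_left hE)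
  have hBm : MeasurableSet {z | b < φ z} := measurableSet_lt measurable_const hφ
  have h1 : μ {ω | (Z ω, W ω) ∈ E} = ∫⁻ z, φ z ∂(μ.map Z) := by
    rw [← Measure.prod_apply hE,
      ← (indepFun_iff_map_prod_eq_prod_map_map hZ.aemeasurable hW.aemeasurable).1 hZW,
      Measure.map_apply (by fun_prop) hE]
    rfl
  rw [h1]
  calc ∫⁻ z, φ z ∂(μ.map Z)
      ≤ ∫⁻ z, ({z | b < φ z}.indicator 1 z + b) ∂(μ.map Z) := by
        refine lintegral_mono fun z => ?_
        by_cases hz : b < φ z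
        · rw [Set.indicator_of_mem (by exact hz)]
          exact le_add_right prob_le_one
        · exact le_add_left (not_lt.1 hz)
    _ = μ.map Z {z | b < φ z} + b := by
        rw [lintegral_add_right _ measurable_const, lintegral_indicator_one hBm]
        simp
    _ ≤ _ := by
        gcongr
        rw [Measure.map_apply hZ hBm]
        refine measure_mono fun ω hω hG => ?_
        exact (h _ hG).not_gt (by rw [← hφeq]; exact hω)

end Independence

/-! ### Markov and Chebyshev bounds on a fresh sample. -/

section Concentration

variable {Ω : Type*} [MeasurableSpace Ω] {μ : Measure Ω}
  {𝒳 𝒵 : Type*} [MeasurableSpace 𝒳] [MeasurableSpace 𝒵] {PX : Measure 𝒳} {N : ℕ}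

theorem measure_le_sqrt_mean_sq {W : Fin N → Ω → 𝒳}
    (hW : ∀ k, Measurable (W k)) (hlaw : ∀ k, μ.map (W k) = PX) {h : 𝒳 → ℝ} (hh : Measurable h)
    {η t : ℝ} (ht : 0 < t) (hη : eLpNorm h 2 PX < ENNReal.ofReal η) :
    μ {ω | t ≤ Real.sqrt ((∑ k, h (W k ω) ^ 2) / N)} ≤ ENNReal.ofReal (η ^ 2 / t ^ 2) := by
  have hη0 : 0 < η := ENNReal.ofReal_pos.1 (bot_le.trans_lt hη)
  have hlint : ∀ k, ∫⁻ ω, ENNReal.ofReal (h (W k ω) ^ 2) ∂μ = eLpNorm h 2 PX ^ 2 := by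
    intro k
    rw [← lintegral_map (μ := μ) (f := fun x => ENNReal.ofReal (h x ^ 2)) (by fun_prop) (hW k),
      hlaw]
    have := eLpNorm_nnreal_pow_eq_lintegral (μ := PX) (f := h) (p := 2) two_ne_zero
    simp only [NNReal.coe_ofNat, ENNReal.coe_ofNat, ENNReal.rpow_ofNat] at this
    rw [this]
    refine lintegral_congr fun x => ?_
    rw [← sq_abs, ENNReal.ofReal_pow (abs_nonneg _), ← Real.enorm_eq_ofReal_abs]
  have hm : Measurable fun ω => ∑ k, ENNReal.ofReal (h (W k ω) ^ 2) := by fun_prop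
  have hmarkov := mul_meas_ge_le_lintegral (μ := μ) hm (ENNReal.ofReal (N * t ^ 2))
  rw [lintegral_finsetSum _ (fun k _ => by fun_prop)] at hmarkov
  simp only [hlint, Finset.sum_const, Finset.card_univ, Fintype.card_fin, nsmul_eq_mul] at hmarkov
  rcases Nat.eq_zero_or_pos N with rfl | hN
  · simp [ht.not_ge]
  have hN' : (0 : ℝ) < N := by exact_mod_cast hN
  have hsub : {ω | t ≤ Real.sqrt ((∑ k, h (W k ω) ^ 2) / N)} ⊆
      {ω | ENNReal.ofReal (N * t ^ 2) ≤ ∑ k, ENNReal.ofReal (h (W k ω) ^ 2)} := by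
    intro ω hω
    simp only [Set.mem_ofPred_eq] at hω ⊢
    rw [← ENNReal.ofReal_sum_of_nonneg fun k _ => sq_nonneg _]
    refine ENNReal.ofReal_le_ofReal ?_
    rw [Real.le_sqrt ht.le (by positivity), le_div_iff₀ hN'] at hω
    linarith
  refine (measure_mono hsub).trans ?_
  have hpos : 0 < N * t ^ 2 := by positivity
  rw [mul_comm, ← ENNReal.le_div_iff_mul_le (Or.inl (ENNReal.ofReal_pos.2 hpos).ne')
    (Or.inl ENNReal.ofReal_ne_top)] at hmarkov
  refine hmarkov.trans ?_
  calc (N : ℝ≥0∞) * eLpNorm h 2 PX ^ 2 / ENNReal.ofReal (N * t ^ 2)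
      ≤ (N : ℝ≥0∞) * ENNReal.ofReal η ^ 2 / ENNReal.ofReal (N * t ^ 2) := by gcongr
    _ = ENNReal.ofReal (η ^ 2 / t ^ 2) := by
        rw [← ENNReal.ofReal_natCast, ← ENNReal.ofReal_pow hη0.le,
          ← ENNReal.ofReal_mul hN'.le, ← ENNReal.ofReal_div_of_pos hpos]
        congr 1
        field_simp

variable [IsProbabilityMeasure μ]

/-- The empirical norm of a random function on an independent sample is small if its `L²` norm is
small. -/
theorem measure_le_sqrt_mean_sq_of_indepFun {Z : Ω → 𝒵} {W : Fin N → Ω → 𝒳} (hZ : Measurable Z)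
    (hW : ∀ k, Measurable (W k)) (hlaw : ∀ k, μ.map (W k) = PX)
    (hZW : IndepFun Z (fun ω k => W k ω) μ) {g : 𝒵 → 𝒳 → ℝ}
    (hg : Measurable (Function.uncurry g)) {η t : ℝ} (ht : 0 < t) :
    μ {ω | t ≤ Real.sqrt ((∑ k, g (Z ω) (W k ω) ^ 2) / N)} ≤
      μ {ω | ENNReal.ofReal η ≤ eLpNorm (g (Z ω)) 2 PX} + ENNReal.ofReal (η ^ 2 / t ^ 2) := by
  have h := measure_prodMk_mem_le hZ (measurable_pi_lambda _ hW) hZW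
    (E := {q | t ≤ Real.sqrt ((∑ k, g q.1 (q.2 k) ^ 2) / N)})
    (G := {z | eLpNorm (g z) 2 PX < ENNReal.ofReal η}) (b := ENNReal.ofReal (η ^ 2 / t ^ 2))
    (by
      refine measurableSet_le measurable_const (Measurable.sqrt (Measurable.div_const ?_ _))
      refine Finset.measurable_sum _ fun k _ => Measurable.pow_const ?_ _
      exact hg.comp (f := fun q : 𝒵 × (Fin N → 𝒳) => (q.1, q.2 k)) (by fun_prop))
    (fun z hz => measure_le_sqrt_mean_sq hW hlaw (hg.comp measurable_prodMk_left) ht hz)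
  simpa using h

/-- Chebyshev for the number of sample points with `|h| ≥ r`: its mean is at least `N r` and its
variance at most `N`. At least `N r / 2` such points give a mean square of at least `r² · r / 2`.
Counting avoids any moment condition on `h`. -/
theorem measure_mean_sq_lt {W : Fin N → Ω → 𝒳} (hN : 0 < N)
    (hW : ∀ k, Measurable (W k)) (hlaw : ∀ k, μ.map (W k) = PX) (hind : iIndepFun W μ)
    {h : 𝒳 → ℝ} (hh : Measurable h) {r : ℝ} (hr : 0 < r)
    (hPX : ENNReal.ofReal r ≤ PX {x | r ≤ |h x|}) :
    μ {ω | (∑ k, h (W k ω) ^ 2) / N < r ^ 3 / 2} ≤ ENNReal.ofReal (4 / (N * r ^ 2)) := by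
  have hN' : (0 : ℝ) < N := by exact_mod_cast hN
  let B : Set 𝒳 := {x | r ≤ |h x|}
  have hB : MeasurableSet B := measurableSet_le measurable_const (by fun_prop)
  let φ : 𝒳 → ℝ := B.indicator 1
  have hφm : Measurable φ := measurable_one.indicator hB
  let Y : Fin N → Ω → ℝ := fun k ω => φ (W k ω)
  have hYm : ∀ k, Measurable (Y k) := fun k => hφm.comp (hW k)
  have hφ01 : ∀ x, 0 ≤ φ x ∧ φ x ≤ 1 := by
    intro x
    simp only [φ, Set.indicator_apply]
    split_ifs <;> simp
  have hYL : ∀ k, MemLp (Y k) 2 μ := fun k =>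
    MemLp.of_bound (hYm k).aestronglyMeasurable 1 (ae_of_all _ fun ω => by
      rw [Real.norm_eq_abs, abs_of_nonneg (hφ01 _).1]
      exact (hφ01 _).2)
  have hvar : ∀ k, variance (Y k) μ ≤ 1 := by
    intro k
    refine (variance_le_expectation_sq (hYm k).aestronglyMeasurable).trans ?_
    have : ∫ ω, (Y k ^ 2) ω ∂μ ≤ ∫ _, (1 : ℝ) ∂μ := by
      refine integral_mono (hYL k).integrable_sq (integrable_const _) fun ω => ?_
      have := hφ01 (W k ω)
      simp only [Pi.pow_apply, Y]
      nlinarith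
    simpa using this
  have hmean : ∀ k, r ≤ ∫ ω, Y k ω ∂μ := by
    intro k
    have h1 : ∫ ω, Y k ω ∂μ = μ.real (W k ⁻¹' B) := by
      rw [← integral_indicator_one ((hW k) hB)]
      rfl
    rw [h1, Measure.real, ← Measure.map_apply (hW k) hB, hlaw]
    refine (ENNReal.ofReal_le_iff_le_toReal ?_).1 hPX
    rw [← hlaw k, Measure.map_apply (hW k) hB]
    exact measure_ne_top _ _
  have hSL : MemLp (∑ k, Y k) 2 μ := memLp_finsetSum' _ fun k _ => hYL k
  have hSvar : variance (∑ k, Y k) μ ≤ N := by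
    rw [IndepFun.variance_sum (fun k _ => hYL k)
      fun k _ l _ hkl => (hind.indepFun hkl).comp hφm hφm]
    exact (Finset.sum_le_sum fun k _ => hvar k).trans (by simp)
  have hSmean : N * r ≤ ∫ ω, (∑ k, Y k) ω ∂μ := by
    simp only [Finset.sum_apply]
    rw [integral_finsetSum _ fun k _ => (hYL k).integrable one_le_two]
    have := Finset.sum_le_sum fun k (_ : k ∈ Finset.univ) => hmean k
    simpa using this
  have hcheb := meas_ge_le_variance_div_sq hSL (c := N * r / 2) (by positivity)
  refine (measure_mono fun ω hω => ?_).trans (hcheb.trans (ENNReal.ofReal_le_ofReal ?_))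
  · simp only [Set.mem_ofPred_eq] at hω ⊢
    rw [div_lt_iff₀ hN'] at hω
    have h1 : r ^ 2 * (∑ k, Y k) ω ≤ ∑ k, h (W k ω) ^ 2 := by
      rw [Finset.sum_apply, Finset.mul_sum]
      refine Finset.sum_le_sum fun k _ => ?_
      simp only [Y, φ, Set.indicator_apply]
      split_ifs with hk
      · rw [Pi.one_apply, mul_one, ← sq_abs (h _)]
        exact pow_le_pow_left₀ hr.le hk 2
      · rw [mul_zero]
        positivity
    have h2 : r ^ 2 * (∑ k, Y k) ω < r ^ 2 * (N * r / 2) := by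
      calc _ ≤ _ := h1
        _ < _ := hω
        _ = _ := by ring
    have h3 := lt_of_mul_lt_mul_left h2 (by positivity)
    rw [abs_sub_comm]
    exact le_trans (by linarith) (le_abs_self _)
  · calc variance (∑ k, Y k) μ / (N * r / 2) ^ 2 ≤ N / (N * r / 2) ^ 2 := by gcongr
      _ = 4 / (N * r ^ 2) := by field_simp; norm_num

/-- The empirical norm of a random function on an independent sample is bounded below if the
function is large on a set of positive probability. -/
theorem measure_mean_sq_lt_of_indepFun {Z : Ω → 𝒵} {W : Fin N → Ω → 𝒳} (hN : 0 < N)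
    (hZ : Measurable Z) (hW : ∀ k, Measurable (W k)) (hlaw : ∀ k, μ.map (W k) = PX)
    (hind : iIndepFun W μ) (hZW : IndepFun Z (fun ω k => W k ω) μ) {g : 𝒵 → 𝒳 → ℝ}
    (hg : Measurable (Function.uncurry g)) {r : ℝ} (hr : 0 < r) :
    μ {ω | (∑ k, g (Z ω) (W k ω) ^ 2) / N < r ^ 3 / 2} ≤
      μ {ω | PX {x | r ≤ |g (Z ω) x|} < ENNReal.ofReal r} + ENNReal.ofReal (4 / (N * r ^ 2)) := by
  have h := measure_prodMk_mem_le hZ (measurable_pi_lambda _ hW) hZW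
    (E := {q | (∑ k, g q.1 (q.2 k) ^ 2) / N < r ^ 3 / 2})
    (G := {z | ENNReal.ofReal r ≤ PX {x | r ≤ |g z x|}}) (b := ENNReal.ofReal (4 / (N * r ^ 2)))
    (by
      refine measurableSet_lt (Measurable.div_const ?_ _) measurable_const
      refine Finset.measurable_sum _ fun k _ => Measurable.pow_const ?_ _
      exact hg.comp (f := fun q : 𝒵 × (Fin N → 𝒳) => (q.1, q.2 k)) (by fun_prop))
    (fun z hz => measure_mean_sq_lt hN hW hlaw hind (hg.comp measurable_prodMk_left) hr hz)
  simpa using h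

/-- Chebyshev with the threshold proportional to the empirical norm of `w`, so that the bound does
not depend on `w`. The inequality in the event is strict to cover `w = 0`. -/
theorem measure_lt_abs_mean_mul {e : Fin N → Ω → ℝ} (hN : 0 < N) {s : ℝ}
    (heL : ∀ k, MemLp (e k) 2 μ) (he0 : ∀ k, ∫ ω, e k ω ∂μ = 0)
    (hes : ∀ k, variance (e k) μ = s) (hind : iIndepFun e μ) (w : Fin N → ℝ) {τ : ℝ}
    (hτ : 0 < τ) :
    μ {ω | τ * Real.sqrt ((∑ k, w k ^ 2) / N) < |(∑ k, e k ω * w k) / N|} ≤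
      ENNReal.ofReal (s / (τ ^ 2 * N)) := by
  have hN' : (0 : ℝ) < N := by exact_mod_cast hN
  rcases (Finset.sum_nonneg fun k (_ : k ∈ Finset.univ) => sq_nonneg (w k)).eq_or_lt with h0 | hpos
  · have hw : ∀ k, w k = 0 := by
      intro k
      have := (Finset.sum_eq_zero_iff_of_nonneg fun k _ => sq_nonneg (w k)).1 h0.symm k
        (Finset.mem_univ k)
      simpa using this
    simp [hw]
  let Y : Fin N → Ω → ℝ := fun k ω => e k ω * w k
  have hYL : ∀ k, MemLp (Y k) 2 μ := fun k => (heL k).mul_const (w k)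
  have hSL : MemLp (∑ k, Y k) 2 μ := memLp_finsetSum' _ fun k _ => hYL k
  have hS0 : ∫ ω, (∑ k, Y k) ω ∂μ = 0 := by
    simp only [Finset.sum_apply]
    rw [integral_finsetSum _ fun k _ => (hYL k).integrable one_le_two]
    exact Finset.sum_eq_zero fun k _ => by simp only [Y]; rw [integral_mul_const, he0, zero_mul]
  have hSvar : variance (∑ k, Y k) μ = s * ∑ k, w k ^ 2 := by
    rw [IndepFun.variance_sum (fun k _ => hYL k) fun k _ l _ hkl =>
      (hind.indepFun hkl).comp (measurable_id.mul_const (w k)) (measurable_id.mul_const (w l)),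
      Finset.mul_sum]
    refine Finset.sum_congr rfl fun k _ => ?_
    simp only [Y]
    rw [variance_mul_const, hes]
  have hc : 0 < N * (τ * Real.sqrt ((∑ k, w k ^ 2) / N)) := by positivity
  refine (measure_mono fun ω hω => ?_).trans ((meas_ge_le_variance_div_sq hSL hc).trans_eq ?_)
  · change _ ≤ |(∑ k, Y k) ω - ∫ ω, (∑ k, Y k) ω ∂μ|
    rw [hS0, sub_zero, Finset.sum_apply]
    change _ < |(∑ k, Y k ω) / N| at hω
    rw [abs_div, abs_of_pos hN', lt_div_iff₀ hN'] at hω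
    linarith
  · rw [hSvar, mul_pow, mul_pow, Real.sq_sqrt (by positivity)]
    congr 1
    field_simp

/-- The empirical inner product of independent centred noise and a random vector is small compared
to the empirical norm of the vector. -/
theorem measure_lt_abs_mean_mul_of_indepFun {Z : Ω → 𝒵} {e : Fin N → Ω → ℝ} (hN : 0 < N) {s : ℝ}
    (hZ : Measurable Z) (hem : ∀ k, Measurable (e k))
    (heL : ∀ k, MemLp (e k) 2 μ) (he0 : ∀ k, ∫ ω, e k ω ∂μ = 0)
    (hes : ∀ k, variance (e k) μ = s) (hind : iIndepFun e μ)
    (hZe : IndepFun Z (fun ω k => e k ω) μ) {w : 𝒵 → Fin N → ℝ} (hw : Measurable w) {τ : ℝ}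
    (hτ : 0 < τ) :
    μ {ω | τ * Real.sqrt ((∑ k, w (Z ω) k ^ 2) / N) < |(∑ k, e k ω * w (Z ω) k) / N|} ≤
      ENNReal.ofReal (s / (τ ^ 2 * N)) := by
  have h := measure_prodMk_mem_le hZ (measurable_pi_lambda _ hem) hZe
    (E := {q | τ * Real.sqrt ((∑ k, w q.1 k ^ 2) / N) < |(∑ k, q.2 k * w q.1 k) / N|})
    (G := Set.univ) (b := ENNReal.ofReal (s / (τ ^ 2 * N)))
    (by
      have h1 : ∀ k, Measurable fun z => w z k := fun k => (measurable_pi_apply k).comp hw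
      refine measurableSet_lt ?_ ?_ <;> fun_prop)
    (fun z _ => measure_lt_abs_mean_mul hN heL he0 hes hind (w z) hτ)
  simpa using h

end Concentration

/-! ### Events of vanishing probability. -/

section Limits

variable {Ω : Type*} [MeasurableSpace Ω] {μ : Measure Ω}

theorem tendsto_measure_of_subset_union {ι : Type*} {l : Filter ι} {A B C : ι → Set Ω}
    (h : ∀ᶠ m in l, A m ⊆ B m ∪ C m) (hB : Tendsto (fun m => μ (B m)) l (𝓝 0))
    (hC : Tendsto (fun m => μ (C m)) l (𝓝 0)) : Tendsto (fun m => μ (A m)) l (𝓝 0) := by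
  have hBC := hB.add hC
  rw [add_zero] at hBC
  refine tendsto_of_tendsto_of_tendsto_of_le_of_le' tendsto_const_nhds hBC
    (Eventually.of_forall fun _ => bot_le) ?_
  filter_upwards [h] with m hm
  exact (measure_mono hm).trans (measure_union_le _ _)

theorem tendsto_measure_iUnion {ι β : Type*} [Finite β] {l : Filter ι} {A : β → ι → Set Ω}
    (h : ∀ b, Tendsto (fun m => μ (A b m)) l (𝓝 0)) :
    Tendsto (fun m => μ (⋃ b, A b m)) l (𝓝 0) := by
  have := Fintype.ofFinite β
  have hs := tendsto_finsetSum Finset.univ fun b _ => h b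
  rw [Finset.sum_const_zero] at hs
  exact tendsto_of_tendsto_of_tendsto_of_le_of_le tendsto_const_nhds hs (fun _ => bot_le)
    fun m => measure_iUnion_fintype_le _ _

theorem tendsto_ofReal_div_natCast {c : ℝ} :
    Tendsto (fun N : ℕ => ENNReal.ofReal (c / N)) atTop (𝓝 0) := by
  rw [← ENNReal.ofReal_zero]
  exact ENNReal.tendsto_ofReal (tendsto_const_div_atTop_nhds_zero_nat c)

theorem tendsto_measure_le_sqrt_mean_sq [IsProbabilityMeasure μ] {𝒳 : Type*} [MeasurableSpace 𝒳]
    {PX : Measure 𝒳} {𝒵 : ℕ → Type*} [∀ m, MeasurableSpace (𝒵 m)] {N : ℕ → ℕ}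
    {Z : ∀ m, Ω → 𝒵 m} {W : ∀ m, Fin (N m) → Ω → 𝒳} (hZ : ∀ m, Measurable (Z m))
    (hW : ∀ m k, Measurable (W m k)) (hlaw : ∀ m k, μ.map (W m k) = PX)
    (hZW : ∀ m, IndepFun (Z m) (fun ω k => W m k ω) μ) {g : ∀ m, 𝒵 m → 𝒳 → ℝ}
    (hg : ∀ m, Measurable (Function.uncurry (g m)))
    (h : ∀ η : ℝ, 0 < η → Tendsto (fun m => μ {ω | ENNReal.ofReal η ≤ eLpNorm (g m (Z m ω)) 2 PX})
      atTop (𝓝 0)) {t : ℝ} (ht : 0 < t) :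
    Tendsto (fun m => μ {ω | t ≤ Real.sqrt ((∑ k, g m (Z m ω) (W m k ω) ^ 2) / N m)})
      atTop (𝓝 0) := by
  rw [ENNReal.tendsto_nhds_zero]
  intro e he
  have he2 : 0 < e / 2 := ENNReal.half_pos he.ne'
  have hlim : Tendsto (fun η : ℝ => ENNReal.ofReal (η ^ 2 / t ^ 2)) (𝓝[>] 0) (𝓝 0) := by
    have hc : Continuous fun η : ℝ => ENNReal.ofReal (η ^ 2 / t ^ 2) :=
      ENNReal.continuous_ofReal.comp (by fun_prop)
    have := hc.tendsto 0
    simp only [ne_eq, OfNat.ofNat_ne_zero, not_false_eq_true, zero_pow, zero_div,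
      ENNReal.ofReal_zero] at this
    exact this.mono_left nhdsWithin_le_nhds
  -- First `η` makes the Markov term small uniformly in `m`; only then does `m` grow.
  obtain ⟨η, hη, hη0⟩ := (((ENNReal.tendsto_nhds_zero.1 hlim) _ he2).and
    self_mem_nhdsWithin).exists
  filter_upwards [ENNReal.tendsto_nhds_zero.1 (h η hη0) _ he2] with m hm
  calc _ ≤ _ := measure_le_sqrt_mean_sq_of_indepFun (hZ m) (hW m) (hlaw m) (hZW m) (hg m) ht
    _ ≤ e / 2 + e / 2 := add_le_add hm hη
    _ = e := ENNReal.add_halves e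

end Limits

/-! ### Deterministic perturbation of the loss. -/

/-- Expand the square and apply Cauchy–Schwarz to the cross term. Independence is not available for
it: a fit depends on the noise of its own data, and noises of different learners may be dependent.
-/
theorem abs_mse_sub_mse_le {p n : ℕ} (g φ : Pred p → ℝ) (D : Dataset p n) :
    |mse g D - mse φ D| ≤
      2 * (Real.sqrt (mse φ D) * Real.sqrt ((∑ j, (g (D j).1 - φ (D j).1) ^ 2) / n)) +
        (∑ j, (g (D j).1 - φ (D j).1) ^ 2) / n := by
  set R := ∑ j, (g (D j).1 - φ (D j).1) ^ 2 with hR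
  set T := ∑ j, ((D j).2 - φ (D j).1) ^ 2 with hT
  set C := ∑ j, ((D j).2 - φ (D j).1) * (g (D j).1 - φ (D j).1) with hC
  have hR0 : 0 ≤ R := Finset.sum_nonneg fun j _ => sq_nonneg _
  have hT0 : 0 ≤ T := Finset.sum_nonneg fun j _ => sq_nonneg _
  have hdec : mse g D - mse φ D = -2 * (C / n) + R / n := by
    have : ∑ j, ((D j).2 - g (D j).1) ^ 2 = T - 2 * C + R := by
      rw [hT, hC, hR, Finset.mul_sum, ← Finset.sum_sub_distrib, ← Finset.sum_add_distrib]
      exact Finset.sum_congr rfl fun j _ => by ring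
    rw [mse, mse, this, ← hT]
    ring
  have hCS : |C / n| ≤ Real.sqrt (mse φ D) * Real.sqrt (R / n) := by
    have h1 : C ^ 2 ≤ T * R := Finset.sum_mul_sq_le_sq_mul_sq _ _ _
    rw [← Real.sqrt_mul (by unfold mse; positivity)]
    refine Real.abs_le_sqrt ?_
    rw [mse, ← hT, div_pow, div_mul_div_comm, ← sq]
    gcongr
  rw [hdec]
  refine (abs_add_le _ _).trans ?_
  rw [abs_mul, abs_of_nonneg (div_nonneg hR0 n.cast_nonneg)]
  rw [show |(-2 : ℝ)| = 2 by norm_num]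
  linarith

theorem exists_forall_abs_sub_lt {s η : ℝ} (hs : 0 ≤ s) (hη : 0 < η) :
    ∃ ρ : ℝ, 0 < ρ ∧ ∀ T R V : ℝ, |T - s| < ρ → 0 ≤ R → Real.sqrt R < ρ →
      |V - T| ≤ 2 * (Real.sqrt T * Real.sqrt R) + R → |V - s| < η := by
  -- For `ρ ≤ 1` one has `√T ≤ s + 2` and `R ≤ √R`, so the total error is below `(2 s + 5) ρ + ρ = 2
  -- (s + 3) ρ`.
  refine ⟨min 1 (η / (2 * (s + 3))), by positivity, fun T R V hT hR hRρ hV => ?_⟩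
  set ρ := min 1 (η / (2 * (s + 3)))
  have hρ1 : ρ ≤ 1 := min_le_left _ _
  have hρη : ρ * (2 * (s + 3)) ≤ η := (le_div_iff₀ (by positivity)).1 (min_le_right _ _)
  have hT' := abs_lt.1 hT
  have hsT : Real.sqrt T ≤ s + 2 := by
    rw [Real.sqrt_le_left (by positivity)]
    nlinarith
  have h0 := Real.sqrt_nonneg R
  have hRR : R = Real.sqrt R * Real.sqrt R := (Real.mul_self_sqrt hR).symm
  have h1 : R ≤ Real.sqrt R := by
    nlinarith
  have h2 : Real.sqrt T * Real.sqrt R ≤ (s + 2) * Real.sqrt R :=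
    mul_le_mul_of_nonneg_right hsT h0
  have h3 : (2 * s + 5) * Real.sqrt R ≤ (2 * s + 5) * ρ :=
    mul_le_mul_of_nonneg_left hRρ.le (by positivity)
  have := abs_sub_le V T s
  linarith

/-! ### Noise moments and the law of large numbers for one learner. -/

section Learner

variable {Ω : Type*} [MeasurableSpace Ω] {μ : Measure Ω} {p : ℕ}
  {PX : Measure (Pred p)} {f : Pred p → ℝ} {X : ℕ → Ω → Pred p}
  {ε : ℕ → Ω → ℝ} {v : ℝ≥0}

theorem memLp_noise (hεm : ∀ k, Measurable (ε k)) (hεl : ∀ k, μ.map (ε k) = gaussianReal 0 v)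
    (k : ℕ) : MemLp (ε k) 2 μ := by
  have h := memLp_id_gaussianReal' (μ := 0) (v := v) 2 (by simp)
  rw [← hεl k, memLp_map_measure_iff (by fun_prop) (hεm k).aemeasurable] at h
  exact h

theorem integral_noise (hεm : ∀ k, Measurable (ε k)) (hεl : ∀ k, μ.map (ε k) = gaussianReal 0 v)
    (k : ℕ) : ∫ ω, ε k ω ∂μ = 0 := by
  have h : ∫ x, x ∂(μ.map (ε k)) = ∫ ω, ε k ω ∂μ :=
    integral_map (f := fun x : ℝ => x) (hεm k).aemeasurable (by fun_prop)
  rw [← h, hεl, integral_id_gaussianReal]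

theorem variance_noise (hεm : ∀ k, Measurable (ε k)) (hεl : ∀ k, μ.map (ε k) = gaussianReal 0 v)
    (k : ℕ) : variance (ε k) μ = v := by
  rw [← variance_id_map (hεm k).aemeasurable, hεl, variance_id_gaussianReal]

/-- The data set made of the predictors `q.1` and the noise `q.2`. -/
def datasetOf (f : Pred p → ℝ) (N : ℕ) (q : (Fin N → Pred p) × (Fin N → ℝ)) : Dataset p N :=
  fun j => (q.1 j, f (q.1 j) + q.2 j)

theorem measurable_datasetOf (hf : Measurable f) (N : ℕ) : Measurable (datasetOf f N) := by
  unfold datasetOf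
  fun_prop

theorem measurable_sample (hf : Measurable f) (hX : ∀ k, Measurable (X k))
    (hε : ∀ k, Measurable (ε k)) (N : ℕ) : Measurable (sample f X ε N) := by
  unfold sample
  have := fun k => hf.comp (hX k)
  fun_prop

variable [IsProbabilityMeasure μ]

/-- The law of large numbers for the loss of a fixed function. -/
theorem tendsto_measure_abs_mse_sub (hf : Measurable f) (hfL : MemLp f 2 PX)
    (hXm : ∀ k, Measurable (X k)) (hεm : ∀ k, Measurable (ε k)) (hXl : ∀ k, μ.map (X k) = PX)
    (hεl : ∀ k, μ.map (ε k) = gaussianReal 0 v) (hXi : iIndepFun X μ) (hεi : iIndepFun ε μ)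
    (hXε : IndepFun (fun ω k => X k ω) (fun ω k => ε k ω) μ) {φ : Pred p → ℝ}
    (hφ : Measurable φ) (hφL : MemLp φ 2 PX) {η : ℝ} (hη : 0 < η) :
    Tendsto (fun n => μ {ω | η ≤ |mse φ (sample f X ε n ω) - (v + ∫ x, (φ x - f x) ^ 2 ∂PX)|})
      atTop (𝓝 0) := by
  let ψ : Pred p × ℝ → ℝ := fun q => (f q.1 + q.2 - φ q.1) ^ 2
  have hψ : Measurable ψ := by fun_prop
  let Y : ℕ → Ω → ℝ := fun k ω => ψ (X k ω, ε k ω)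
  have hYm : ∀ k, Measurable (Y k) := fun k => hψ.comp ((hXm k).prodMk (hεm k))
  have hpair : ∀ k, IndepFun (X k) (ε k) μ := fun k =>
    hXε.comp (measurable_pi_apply k) (measurable_pi_apply k)
  have hind : Pairwise (Function.onFun (fun Y Y' => IndepFun Y Y' μ) Y) := by
    intro k l hkl
    exact (indepFun_prodMk_prodMk (hXm k) (hXm l) (hεm k) (hεm l) (hXi.indepFun hkl)
      (hεi.indepFun hkl) (hXε.comp (φ := fun x => (x k, x l)) (ψ := fun x => (x k, x l))
        (by fun_prop) (by fun_prop))).comp hψ hψ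
  have hident : ∀ k, IdentDistrib (Y k) (Y 0) μ μ := by
    intro k
    have h : IdentDistrib (fun ω => (X k ω, ε k ω)) (fun ω => (X 0 ω, ε 0 ω)) μ μ := by
      refine ⟨by fun_prop, by fun_prop, ?_⟩
      rw [(hpair k).map_prod_eq_prod_map_map (by fun_prop) (by fun_prop),
        (hpair 0).map_prod_eq_prod_map_map (by fun_prop) (by fun_prop), hXl, hXl, hεl, hεl]
    exact h.comp hψ
  have hεL := memLp_noise hεm hεl 0
  have huL : MemLp (fun ω => f (X 0 ω) - φ (X 0 ω)) 2 μ := by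
    have h := hfL.sub hφL
    rw [← hXl 0, memLp_map_measure_iff (by fun_prop) (hXm 0).aemeasurable] at h
    exact h
  have hYeq : Y 0 = fun ω => (f (X 0 ω) - φ (X 0 ω)) ^ 2
      + 2 * ((f (X 0 ω) - φ (X 0 ω)) * ε 0 ω) + ε 0 ω ^ 2 := by
    ext ω
    simp only [Y, ψ]
    ring
  have hi1 := huL.integrable_sq
  have hi2 : Integrable (fun ω => (f (X 0 ω) - φ (X 0 ω)) * ε 0 ω) μ := huL.integrable_mul hεL
  have hi3 := hεL.integrable_sq
  have hi12 : Integrable (fun ω => (f (X 0 ω) - φ (X 0 ω)) ^ 2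
      + 2 * ((f (X 0 ω) - φ (X 0 ω)) * ε 0 ω)) μ := hi1.add (hi2.const_mul 2)
  have hint : Integrable (Y 0) μ := by
    rw [hYeq]
    exact hi12.add hi3
  have hmean : ∫ ω, Y 0 ω ∂μ = v + ∫ x, (φ x - f x) ^ 2 ∂PX := by
    have e1 : ∫ ω, (f (X 0 ω) - φ (X 0 ω)) ^ 2 ∂μ = ∫ x, (φ x - f x) ^ 2 ∂PX := by
      rw [← hXl 0, integral_map (hXm 0).aemeasurable (by fun_prop)]
      exact integral_congr_ae (ae_of_all _ fun ω => by ring)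
    have e2 : ∫ ω, (f (X 0 ω) - φ (X 0 ω)) * ε 0 ω ∂μ = 0 := by
      have h : IndepFun (fun ω => f (X 0 ω) - φ (X 0 ω)) (ε 0) μ :=
        (hpair 0).comp (hf.sub hφ) measurable_id
      rw [h.integral_fun_mul_eq_mul_integral huL.aestronglyMeasurable hεL.aestronglyMeasurable,
        integral_noise hεm hεl, mul_zero]
    have e3 : ∫ ω, ε 0 ω ^ 2 ∂μ = v := by
      rw [← variance_noise hεm hεl 0, variance_of_integral_eq_zero (hεm 0).aemeasurable
        (integral_noise hεm hεl 0)]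
    simp only [hYeq]
    rw [integral_add hi12 hi3, integral_add hi1 (hi2.const_mul 2),
      integral_const_mul, e1, e2, e3]
    ring
  have hslln := strong_law_ae_real Y hint hind hident
  rw [hmean] at hslln
  have hm := tendstoInMeasure_of_tendsto_ae (fun n => ?_) hslln
  · have := (tendstoInMeasure_iff_norm.1 hm) η hη
    refine this.congr fun n => ?_
    simp only [Real.norm_eq_abs, mse, sample]
    simp only [← Fin.sum_univ_eq_sum_range (fun k => Y k _)]
    rfl
  · exact ((Finset.measurable_sum _ fun k _ => hYm k).div_const _).aestronglyMeasurable

end Learner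

/-! ### Cross validation rejects misspecified methods. -/

section Selection

variable {Ω : Type*} [MeasurableSpace Ω] {μ : Measure Ω} [IsProbabilityMeasure μ] {p : ℕ}
  {PX : Measure (Pred p)} {f : Pred p → ℝ} {X : ℕ → Ω → Pred p}
  {ε : ℕ → Ω → ℝ} {v : ℝ≥0}

/-- With `G`, `H` the mean squared errors of `g`, `h`, the losses differ by at least `√G (√G - 2 ρ)
- H - 2 ρ √H`. The choice of `ρ` gives `√G ≥ 4 ρ`, so this exceeds `8 ρ² - 3 ρ²`. -/
theorem lt_mse_of_mean_sq {N : ℕ} {r ρ : ℝ} (hρ : 0 < ρ) (hr : 16 * ρ ^ 2 = r ^ 3 / 2)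
    {f g h : Pred p → ℝ} {x : Fin N → Pred p} {e : Fin N → ℝ}
    (hg : r ^ 3 / 2 ≤ (∑ k, (g (x k) - f (x k)) ^ 2) / N)
    (hh : Real.sqrt ((∑ k, (h (x k) - f (x k)) ^ 2) / N) < ρ)
    (hgc : |(∑ k, e k * (g (x k) - f (x k))) / N| ≤
      ρ * Real.sqrt ((∑ k, (g (x k) - f (x k)) ^ 2) / N))
    (hhc : |(∑ k, e k * (h (x k) - f (x k))) / N| ≤
      ρ * Real.sqrt ((∑ k, (h (x k) - f (x k)) ^ 2) / N)) :
    mse h (fun k => (x k, f (x k) + e k) : Dataset p N) <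
      mse g (fun k => (x k, f (x k) + e k) : Dataset p N) := by
  have hdec : ∀ g : Pred p → ℝ, mse g (fun k => (x k, f (x k) + e k) : Dataset p N) =
      (∑ k, e k ^ 2) / N - 2 * ((∑ k, e k * (g (x k) - f (x k))) / N) +
        (∑ k, (g (x k) - f (x k)) ^ 2) / N := by
    intro g
    have : ∑ k, (f (x k) + e k - g (x k)) ^ 2 = ∑ k, e k ^ 2 -
        2 * ∑ k, e k * (g (x k) - f (x k)) + ∑ k, (g (x k) - f (x k)) ^ 2 := by
      rw [Finset.mul_sum, ← Finset.sum_sub_distrib, ← Finset.sum_add_distrib]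
      exact Finset.sum_congr rfl fun j _ => by ring
    rw [mse, this]
    ring
  rw [hdec, hdec]
  set G := (∑ k, (g (x k) - f (x k)) ^ 2) / (N : ℝ) with hG
  set H := (∑ k, (h (x k) - f (x k)) ^ 2) / (N : ℝ) with hH
  have hG0 : 0 ≤ G := by positivity
  have hH0 : 0 ≤ H := by positivity
  have hG1 : 4 * ρ ≤ Real.sqrt G := by
    rw [Real.le_sqrt (by positivity) hG0]
    nlinarith
  have hG2 := Real.mul_self_sqrt hG0
  have hH2 := Real.mul_self_sqrt hH0
  have hH1 := Real.sqrt_nonneg H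
  have h1 := abs_le.1 hgc
  have h2 := abs_le.1 hhc
  nlinarith

/-- A misspecified method is not selected in the presence of a consistent method, with probability
tending to one. -/
theorem tendsto_measure_mse_le_mse (hf : Measurable f)
    (hXm : ∀ k, Measurable (X k)) (hεm : ∀ k, Measurable (ε k)) (hXl : ∀ k, μ.map (X k) = PX)
    (hεl : ∀ k, μ.map (ε k) = gaussianReal 0 v) (hXi : iIndepFun X μ) (hεi : iIndepFun ε μ)
    (hXε : IndepFun (fun ω k => X k ω) (fun ω k => ε k ω) μ) {δ δ' : Method p}
    (hδ : ∀ n, Measurable fun z : Dataset p n × Pred p => δ n z.1 z.2)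
    (hδ' : ∀ n, Measurable fun z : Dataset p n × Pred p => δ' n z.1 z.2)
    (hcons : IsConsistent μ PX f X ε δ) (hmis : IsMisspecified μ PX f X ε δ') :
    Tendsto (fun N => μ {ω |
      mse (δ' N (sample f X ε N ω)) (fun k : Fin N => (X (N + k) ω, f (X (N + k) ω) + ε (N + k) ω))
      ≤ mse (δ N (sample f X ε N ω))
        (fun k : Fin N => (X (N + k) ω, f (X (N + k) ω) + ε (N + k) ω))}) atTop (𝓝 0) := by
  obtain ⟨r, hr, hmis⟩ := hmis
  let ρ : ℝ := Real.sqrt (r ^ 3 / 2) / 4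
  have hρ : 0 < ρ := by positivity
  have hρr : 16 * ρ ^ 2 = r ^ 3 / 2 := by
    simp only [ρ, div_pow]
    rw [Real.sq_sqrt (by positivity)]
    ring
  have hZ : ∀ N, Measurable (sample f X ε N) := measurable_sample hf hXm hεm
  have hgm : ∀ {δ : Method p}, (∀ n, Measurable fun z : Dataset p n × Pred p => δ n z.1 z.2) →
      ∀ N, Measurable (Function.uncurry fun (z : Dataset p N) x => δ N z x - f x) :=
    fun hδ N => (hδ N).sub (hf.comp measurable_snd)
  have hXX : ∀ N : ℕ, IndepFun (fun ω (k : Fin N) => X k ω) (fun ω (k : Fin N) => X (N + k) ω) μ :=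
    fun N => indepFun_of_disjoint_range hXi hXm (fun k : Fin N => (k : ℕ)) (fun k : Fin N => N + k)
      (by intro s t; omega)
  have hεε : ∀ N : ℕ, IndepFun (fun ω (k : Fin N) => ε k ω) (fun ω (k : Fin N) => ε (N + k) ω) μ :=
    fun N => indepFun_of_disjoint_range hεi hεm (fun k : Fin N => (k : ℕ)) (fun k : Fin N => N + k)
      (by intro s t; omega)
  have hZW : ∀ N, IndepFun (sample f X ε N) (fun ω (k : Fin N) => X (N + k) ω) μ := by
    intro N
    have h := indepFun_prodMk_prodMk (A := fun ω (k : Fin N) => X k ω)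
      (A' := fun ω (k : Fin N) => X (N + k) ω) (B := fun ω (k : Fin N) => ε k ω)
      (B' := fun _ => ()) (by fun_prop) (by fun_prop) (by fun_prop) (by fun_prop) (hXX N)
      (indepFun_const_right _ _)
      (hXε.comp (φ := fun x => (fun k : Fin N => x k, fun k : Fin N => x (N + k)))
        (ψ := fun x => (fun k : Fin N => x k, ())) (by fun_prop) (by fun_prop))
    exact h.comp (measurable_datasetOf hf N) measurable_fst
  -- The weights in the noise cross term are functions of the training sample and the test
  -- predictors; the test noise is independent of these jointly.
  have hZe : ∀ N, IndepFun (fun ω => (sample f X ε N ω, fun k : Fin N => X (N + k) ω))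
      (fun ω (k : Fin N) => ε (N + k) ω) μ := by
    intro N
    have h := indepFun_prodMk_prodMk
      (A := fun ω => (fun k : Fin N => X k ω, fun k : Fin N => X (N + k) ω))
      (A' := fun _ => ()) (B := fun ω (k : Fin N) => ε k ω)
      (B' := fun ω (k : Fin N) => ε (N + k) ω) (by fun_prop) (by fun_prop) (by fun_prop)
      (by fun_prop) (indepFun_const_right _ _) (hεε N)
      (hXε.comp (φ := fun x => ((fun k : Fin N => x k, fun k : Fin N => x (N + k)), ()))
        (ψ := fun x => (fun k : Fin N => x k, fun k : Fin N => x (N + k)))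
        (by fun_prop) (by fun_prop))
    have hm := measurable_datasetOf hf N
    exact h.comp (φ := fun q => (datasetOf f N (q.1.1, q.2), q.1.2)) (ψ := fun q => q.2)
      (by fun_prop) measurable_snd
  have hcross : ∀ {δ : Method p},
      (∀ n, Measurable fun z : Dataset p n × Pred p => δ n z.1 z.2) →
      Tendsto (fun N : ℕ => μ {ω | ρ * Real.sqrt ((∑ k : Fin N,
        (δ N (sample f X ε N ω) (X (N + k) ω) - f (X (N + k) ω)) ^ 2) / N) <
        |(∑ k : Fin N, ε (N + k) ω * (δ N (sample f X ε N ω) (X (N + k) ω) - f (X (N + k) ω))) / N|})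
        atTop (𝓝 0) := by
    intro δ hδ
    refine tendsto_of_tendsto_of_tendsto_of_le_of_le' tendsto_const_nhds
      (tendsto_ofReal_div_natCast (c := v / ρ ^ 2)) (Eventually.of_forall fun _ => bot_le) ?_
    filter_upwards [eventually_gt_atTop 0] with N hN
    rw [div_div]
    refine measure_lt_abs_mean_mul_of_indepFun
      (Z := fun ω => (sample f X ε N ω, fun k : Fin N => X (N + k) ω))
      (e := fun k : Fin N => ε (N + k)) (w := fun z k => δ N z.1 (z.2 k) - f (z.2 k)) hN
      ((hZ N).prodMk (by fun_prop)) (fun k => hεm _)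
      (fun k => memLp_noise hεm hεl _) (fun k => integral_noise hεm hεl _)
      (fun k => variance_noise hεm hεl _) (hεi.precomp (g := fun k : Fin N => N + k)
        (by intro s t; simp [Fin.ext_iff])) (hZe N) ?_ hρ
    refine measurable_pi_lambda _ fun k => ?_
    exact (hgm hδ N).comp
      (f := fun z : Dataset p N × (Fin N → Pred p) => (z.1, z.2 k)) (by fun_prop)
  have hlow : Tendsto (fun N : ℕ => μ {ω | (∑ k : Fin N,
      (δ' N (sample f X ε N ω) (X (N + k) ω) - f (X (N + k) ω)) ^ 2) / N < r ^ 3 / 2})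
      atTop (𝓝 0) := by
    have hlim := hmis.add (tendsto_ofReal_div_natCast (c := 4 / r ^ 2))
    rw [add_zero] at hlim
    refine tendsto_of_tendsto_of_tendsto_of_le_of_le' tendsto_const_nhds hlim
      (Eventually.of_forall fun _ => bot_le) ?_
    filter_upwards [eventually_gt_atTop 0] with N hN
    rw [div_div, mul_comm (r ^ 2)]
    exact measure_mean_sq_lt_of_indepFun (W := fun k : Fin N => X (N + k)) hN (hZ N)
      (fun k => hXm _) (fun k => hXl _) (hXi.precomp (g := fun k : Fin N => N + k)
        (by intro s t; simp [Fin.ext_iff])) (hZW N) (hgm hδ' N) hr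
  have hhigh : Tendsto (fun N : ℕ => μ {ω | ρ ≤ Real.sqrt ((∑ k : Fin N,
      (δ N (sample f X ε N ω) (X (N + k) ω) - f (X (N + k) ω)) ^ 2) / N)}) atTop (𝓝 0) :=
    tendsto_measure_le_sqrt_mean_sq (N := fun N => N) (Z := fun N => sample f X ε N)
      (W := fun N (k : Fin N) => X (N + k)) (PX := PX) hZ
      (fun N k => hXm _) (fun N k => hXl _) hZW (g := fun N z x => δ N z x - f x) (hgm hδ)
      hcons.1 hρ
  refine tendsto_measure_of_subset_union (Eventually.of_forall fun N => ?_)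
    (tendsto_measure_of_subset_union (Eventually.of_forall fun N => subset_rfl) hlow hhigh)
    (tendsto_measure_of_subset_union (Eventually.of_forall fun N => subset_rfl) (hcross hδ)
      (hcross hδ'))
  intro ω hω
  by_contra hnot
  simp only [Set.mem_union, not_or, Set.mem_ofPred_eq, not_lt, not_le] at hnot
  obtain ⟨⟨h1, h2⟩, h3, h4⟩ := hnot
  exact (lt_mse_of_mean_sq (x := fun k : Fin N => X (N + k) ω) (e := fun k => ε (N + k) ω) hρ hρr
    h1 h2 h4 h3).not_ge hω

end Selection

/-! ### Limits of the exchanged losses. -/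

section Exchange

variable {Ω : Type*} [MeasurableSpace Ω] {μ : Measure Ω} [IsProbabilityMeasure μ] {L p : ℕ}
  {PX : Measure (Pred p)} {f : Fin L → Pred p → ℝ} {X : Fin L → ℕ → Ω → Pred p}
  {ε : Fin L → ℕ → Ω → ℝ} {v : Fin L → ℝ≥0}

/-- The loss of a consistent estimate of learner `i` on the data of learner `j` tends to the noise
variance plus the squared distance of the regression functions. -/
theorem tendsto_measure_abs_exchanged_mse_sub (hf : ∀ i, Measurable (f i))
    (hfL : ∀ i, MemLp (f i) 2 PX)
    (hXm : ∀ i k, Measurable (X i k)) (hεm : ∀ i k, Measurable (ε i k))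
    (hXl : ∀ i k, μ.map (X i k) = PX) (hεl : ∀ i k, μ.map (ε i k) = gaussianReal 0 (v i))
    (hXi : iIndepFun (fun q : Fin L × ℕ => X q.1 q.2) μ) (hεi : ∀ i, iIndepFun (ε i) μ)
    (hXε : IndepFun (fun ω (q : Fin L × ℕ) => X q.1 q.2 ω)
      (fun ω (q : Fin L × ℕ) => ε q.1 q.2 ω) μ)
    {n : ℕ → Fin L → ℕ} (hn : ∀ i, Tendsto (fun m => n m i) atTop atTop) {i : Fin L} (j : Fin L)
    {δ : Method p} (hδ : ∀ n, Measurable fun z : Dataset p n × Pred p => δ n z.1 z.2)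
    (hcons : IsConsistent μ PX (f i) (X i) (ε i) δ) {η : ℝ} (hη : 0 < η) :
    Tendsto (fun m => μ {ω | η ≤ |mse (δ (n m i) (sample (f i) (X i) (ε i) (n m i) ω))
      (sample (f j) (X j) (ε j) (n m j) ω) - (v j + ∫ x, (f i x - f j x) ^ 2 ∂PX)|})
      atTop (𝓝 0) := by
  have hR : ∀ t : ℝ, 0 < t → Tendsto (fun m => μ {ω | t ≤ Real.sqrt ((∑ k : Fin (n m j),
      (δ (n m i) (sample (f i) (X i) (ε i) (n m i) ω) (X j k ω) - f i (X j k ω)) ^ 2) / n m j)})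
      atTop (𝓝 0) := by
    intro t ht
    -- On its own data the fit is not independent of the predictors, and empirical consistency is
    -- used. On another learner's predictors, `L²` consistency transfers by independence.
    rcases eq_or_ne i j with rfl | hij
    · exact (hcons.2 t ht).comp (hn i)
    refine tendsto_measure_le_sqrt_mean_sq (N := fun m => n m j)
      (Z := fun m => sample (f i) (X i) (ε i) (n m i)) (W := fun m (k : Fin (n m j)) => X j k)
      (PX := PX) (fun m => measurable_sample (hf i) (hXm i) (hεm i) _) (fun m k => hXm _ _)
      (fun m k => hXl _ _) (fun m => ?_) (g := fun m z x => δ (n m i) z x - f i x)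
      (fun m => (hδ _).sub ((hf i).comp measurable_snd))
      (fun η hη => (hcons.1 η hη).comp (hn i)) ht
    have hXX := indepFun_of_disjoint_range hXi (fun q => hXm q.1 q.2)
      (fun k : Fin (n m i) => (i, (k : ℕ))) (fun k : Fin (n m j) => (j, (k : ℕ)))
      (fun s t h => hij (congrArg Prod.fst h))
    have h := indepFun_prodMk_prodMk (A := fun ω (k : Fin (n m i)) => X i k ω)
      (A' := fun ω (k : Fin (n m j)) => X j k ω) (B := fun ω (k : Fin (n m i)) => ε i k ω)
      (B' := fun _ => ()) (by fun_prop) (by fun_prop) (by fun_prop) (by fun_prop) hXX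
      (indepFun_const_right _ _)
      (hXε.comp (φ := fun x => (fun k : Fin (n m i) => x (i, k), fun k : Fin (n m j) => x (j, k)))
        (ψ := fun x => (fun k : Fin (n m i) => x (i, k), ())) (by fun_prop) (by fun_prop))
    exact h.comp (measurable_datasetOf (hf i) _) measurable_fst
  have hs : 0 ≤ (v j : ℝ) + ∫ x, (f i x - f j x) ^ 2 ∂PX :=
    add_nonneg (v j).2 (integral_nonneg fun x => sq_nonneg _)
  obtain ⟨ρ, hρ, hdet⟩ := exists_forall_abs_sub_lt hs hη
  have hT := (tendsto_measure_abs_mse_sub (hf j) (hfL j) (hXm j) (hεm j) (hXl j) (hεl j)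
    (hXi.precomp (g := fun k : ℕ => (j, k)) (fun s t h => congrArg Prod.snd h)) (hεi j)
    (hXε.comp (φ := fun (x : Fin L × ℕ → Pred p) k => x (j, k))
      (ψ := fun (x : Fin L × ℕ → ℝ) k => x (j, k)) (by fun_prop) (by fun_prop))
    (hf i) (hfL i) hρ).comp (hn j)
  refine tendsto_measure_of_subset_union (Eventually.of_forall fun m => ?_) hT (hR ρ hρ)
  intro ω hω
  by_contra hnot
  simp only [Set.mem_union, not_or, Set.mem_ofPred_eq, not_le] at hnot
  exact (hdet _ _ _ hnot.1 (by positivity) hnot.2 (abs_mse_sub_mse_le _ _ _)).not_ge hω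

end Exchange

/-! ### Distances in `L²`, existence of outputs, and the main theorem. -/

theorem norm_toLp_sub_sq {α : Type*} [MeasurableSpace α] {ν : Measure α} {f g : α → ℝ}
    (hf : MemLp f 2 ν) (hg : MemLp g 2 ν) :
    ‖hf.toLp f - hg.toLp g‖ ^ 2 = ∫ x, (f x - g x) ^ 2 ∂ν := by
  rw [← MemLp.toLp_sub, ← real_inner_self_eq_norm_sq, L2.inner_def]
  refine integral_congr_ae ?_
  filter_upwards [(hf.sub hg).coeFn_toLp] with x hx
  rw [hx]
  simp [sq]

theorem exists_isOutput {L p K : ℕ} {κ : Fin L → Fin K} (hκ : Function.Surjective κ)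
    {n : Fin L → ℕ} {M : Fin L → Set (Method p)} (hfin : ∀ i, (M i).Finite)
    (hne : ∀ i, (M i).Nonempty) (a : ℝ) (D : ∀ i, Dataset p (n i)) :
    ∃ c : Fin L → Fin K, IsOutput M a K D c := by
  choose δ hδ hmin using fun i => Set.exists_min_image (M i)
    (fun δ => mse (δ (n i / 2) (firstHalf (D i))) (secondHalf (D i))) (hfin i) (hne i)
  obtain ⟨U, hU⟩ := exists_isTopEigenvectors (K := K)
    (by simpa using Fintype.card_le_of_surjective κ hκ)
    (isHermitian_laplacian_similarity a (v := dissim D fun i => δ i (n i) (D i))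
      fun i j => add_comm _ _)
  have : Nonempty (Fin L → Fin K) := ⟨κ⟩
  obtain ⟨c, hc⟩ := Finite.exists_min (kmeansCost (unitRow U) : (Fin L → Fin K) → ℝ)
  exact ⟨c, δ, fun i => ⟨hδ i, hmin i⟩, U, hU, hc⟩

end SEC

theorem theorem1
    -- `L` learners, `p` predictors, `K` distinct regression functions
    {L p K : ℕ} {Ω : Type*} [MeasurableSpace Ω] (μ : Measure Ω) [IsProbabilityMeasure μ]
    (PX : Measure (SEC.Pred p)) [IsProbabilityMeasure PX]
    (F : Fin K → SEC.Pred p → ℝ) (f : Fin L → SEC.Pred p → ℝ)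
    (hFmeas : ∀ k, Measurable (F k)) (hFL2 : ∀ k, MemLp (F k) 2 PX)
    (hFdiff : ∀ k l, k ≠ l → 0 < eLpNorm (F k - F l) ∞ PX)
    (hf : Set.range f = Set.range F)
    -- predictors and noise of the `j`-th data point of learner `i`
    (X : Fin L → ℕ → Ω → SEC.Pred p) (ε : Fin L → ℕ → Ω → ℝ) (σ : Fin L → ℝ≥0)
    (hXmeas : ∀ i j, Measurable (X i j)) (hεmeas : ∀ i j, Measurable (ε i j))
    (hXlaw : ∀ i j, μ.map (X i j) = PX)
    (hεlaw : ∀ i j, μ.map (ε i j) = gaussianReal 0 (σ i ^ 2))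
    (hXindep : iIndepFun (fun q : Fin L × ℕ => X q.1 q.2) μ)
    (hεindep : ∀ i, iIndepFun (ε i) μ)
    (hXε : IndepFun (fun ω (q : Fin L × ℕ) => X q.1 q.2 ω)
      (fun ω (q : Fin L × ℕ) => ε q.1 q.2 ω) μ)
    -- parametric and nonparametric candidate methods of learner `i`
    (Mp Mn : Fin L → Set (SEC.Method p))
    (hMfin : ∀ i, (Mp i ∪ Mn i).Finite)
    (hMmeas : ∀ i, ∀ δ ∈ Mp i ∪ Mn i, ∀ n,
      Measurable fun z : SEC.Dataset p n × SEC.Pred p => δ n z.1 z.2)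
    (hMn : ∀ i, ∀ δ ∈ Mn i, SEC.IsConsistent μ PX (f i) (X i) (ε i) δ)
    (hMp : ∀ i, ∀ δ ∈ Mp i, SEC.IsConsistent μ PX (f i) (X i) (ε i) δ ∨
      SEC.IsMisspecified μ PX (f i) (X i) (ε i) δ)
    (hMex : ∀ i, ∃ δ ∈ Mp i ∪ Mn i, SEC.IsConsistent μ PX (f i) (X i) (ε i) δ)
    -- sample sizes: even, and growing for each learner
    (n : ℕ → Fin L → ℕ) (hneven : ∀ m i, Even (n m i))
    (hn : ∀ i, Tendsto (fun m => n m i) atTop atTop)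
    (a : ℝ) (ha : 0 < a) :
    (∀ m ω, ∃ c : Fin L → Fin K, SEC.IsOutput (fun i => Mp i ∪ Mn i) a K
      (fun i => SEC.sample (f i) (X i) (ε i) (n m i) ω) c) ∧
    Tendsto (fun m => μ {ω | ∃ c : Fin L → Fin K,
        SEC.IsOutput (fun i => Mp i ∪ Mn i) a K
          (fun i => SEC.sample (f i) (X i) (ε i) (n m i) ω) c ∧
        ¬ ∀ i j, c i = c j ↔ f i =ᵐ[PX] f j})
      atTop (𝓝 0) := by
  have hFinj : Function.Injective F := by
    intro k l hkl
    by_contra hne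
    have := hFdiff k l hne
    simp [hkl] at this
  have hκ : ∀ i, ∃ k, F k = f i := fun i => by
    have : f i ∈ Set.range F := hf ▸ Set.mem_range_self i
    exact this
  choose κ hκ using hκ
  have hsurj : Function.Surjective κ := by
    intro k
    have : F k ∈ Set.range f := hf ▸ Set.mem_range_self k
    obtain ⟨i, hi⟩ := this
    exact ⟨i, hFinj ((hκ i).trans hi)⟩
  have hfm : ∀ i, Measurable (f i) := fun i => hκ i ▸ hFmeas _
  have hfL : ∀ i, MemLp (f i) 2 PX := fun i => hκ i ▸ hFL2 _
  have hae : ∀ k l, F k =ᵐ[PX] F l → k = l := by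
    intro k l hkl
    by_contra hne
    have h := hFdiff k l hne
    have h0 : F k - F l =ᵐ[PX] 0 := by
      filter_upwards [hkl] with x hx
      simp [hx]
    rw [eLpNorm_congr_ae h0] at h
    simp at h
  refine ⟨fun m ω => SEC.exists_isOutput hsurj hMfin
    (fun i => (hMex i).imp fun δ hδ => hδ.1) a _, ?_⟩
  let x : Fin K → Lp ℝ 2 PX := fun k => (hFL2 k).toLp (F k)
  have hx : Function.Injective x := fun k l hkl => hae k l ((MemLp.toLp_eq_toLp_iff _ _).1 hkl)
  have hdist : ∀ i j, ‖x (κ i) - x (κ j)‖ ^ 2 = ∫ y, (f i y - f j y) ^ 2 ∂PX := by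
    intro i j
    rw [← hκ i, ← hκ j]
    exact SEC.norm_toLp_sub_sq _ _
  -- The factor `b = 2` arises because each of the two absolute values in the dissimilarity tends to
  -- one squared distance.
  obtain ⟨η, hη, hball⟩ := Metric.eventually_nhds_iff.1
    (SEC.eventually_label_iff_of_sqDist hsurj hx ha two_pos)
  have hMfin' : ∀ i, Finite ↥(Mp i ∪ Mn i) := fun i => hMfin i
  have hsel : Tendsto (fun m => μ (⋃ i, ⋃ δ : ↥(Mp i ∪ Mn i),
      {ω | ¬ SEC.IsConsistent μ PX (f i) (X i) (ε i) δ ∧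
        SEC.IsSelected (Mp i ∪ Mn i) (SEC.sample (f i) (X i) (ε i) (n m i) ω) δ}))
      atTop (𝓝 0) := by
    refine SEC.tendsto_measure_iUnion fun i => SEC.tendsto_measure_iUnion fun δ => ?_
    by_cases hc : SEC.IsConsistent μ PX (f i) (X i) (ε i) δ
    · simp [hc]
    have hmis : SEC.IsMisspecified μ PX (f i) (X i) (ε i) δ := by
      rcases δ.2 with h | h
      · exact (hMp i _ h).resolve_left hc
      · exact absurd (hMn i _ h) hc
    obtain ⟨δ', hδ', hc'⟩ := hMex i
    have h := (SEC.tendsto_measure_mse_le_mse (hfm i) (hXmeas i) (hεmeas i) (hXlaw i) (hεlaw i)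
      (hXindep.precomp (g := fun k : ℕ => (i, k)) (fun s t h => congrArg Prod.snd h)) (hεindep i)
      (hXε.comp (φ := fun (x : Fin L × ℕ → SEC.Pred p) k => x (i, k))
        (ψ := fun (x : Fin L × ℕ → ℝ) k => x (i, k)) (by fun_prop) (by fun_prop))
      (hMmeas i δ' hδ') (hMmeas i δ δ.2) hc' hmis).comp
      ((Nat.tendsto_div_const_atTop two_ne_zero).comp (hn i))
    refine tendsto_of_tendsto_of_tendsto_of_le_of_le tendsto_const_nhds h (fun _ => bot_le)
      fun m => measure_mono fun ω hω => ?_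
    -- By unfolding, the two halves of the sample are its first `n / 2` points and the points of
    -- index `n / 2 + k`, as in the selection lemma with `N = n / 2`.
    exact hω.2.2 δ' hδ'
  have hexc : Tendsto (fun m => μ (⋃ i, ⋃ δ : ↥(Mp i ∪ Mn i), ⋃ j,
      {ω | SEC.IsConsistent μ PX (f i) (X i) (ε i) δ ∧
        η / 4 ≤ |SEC.mse (δ.1 (n m i) (SEC.sample (f i) (X i) (ε i) (n m i) ω))
          (SEC.sample (f j) (X j) (ε j) (n m j) ω) -
            ((σ j ^ 2 : ℝ≥0) + ∫ x, (f i x - f j x) ^ 2 ∂PX)|})) atTop (𝓝 0) := by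
    refine SEC.tendsto_measure_iUnion fun i => SEC.tendsto_measure_iUnion fun δ =>
      SEC.tendsto_measure_iUnion fun j => ?_
    by_cases hc : SEC.IsConsistent μ PX (f i) (X i) (ε i) δ
    · simp only [hc, true_and]
      exact SEC.tendsto_measure_abs_exchanged_mse_sub hfm hfL hXmeas hεmeas hXlaw hεlaw hXindep
        hεindep hXε hn j (hMmeas i δ δ.2) hc (by positivity)
    · simp [hc]
  refine SEC.tendsto_measure_of_subset_union (Eventually.of_forall fun m => ?_) hsel hexc
  rintro ω ⟨c, ⟨δ, hδ, U, hU, hkm⟩, hbad⟩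
  by_contra hnot
  simp only [Set.mem_union, Set.mem_iUnion, not_or, not_exists, Set.mem_ofPred_eq, not_and, not_le]
    at hnot
  obtain ⟨h1, h2⟩ := hnot
  have hcons : ∀ i, SEC.IsConsistent μ PX (f i) (X i) (ε i) (δ i) := by
    intro i
    by_contra hc
    exact h1 i ⟨δ i, (hδ i).1⟩ hc (hδ i)
  have hclose : ∀ i j, |SEC.mse (δ i (n m i) (SEC.sample (f i) (X i) (ε i) (n m i) ω))
      (SEC.sample (f j) (X j) (ε j) (n m j) ω) -
        ((σ j ^ 2 : ℝ≥0) + ‖x (κ i) - x (κ j)‖ ^ 2)| < η / 4 := by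
    intro i j
    rw [hdist]
    exact h2 i ⟨δ i, (hδ i).1⟩ j (hcons i)
  have hlab := hball (y := SEC.dissim (fun i => SEC.sample (f i) (X i) (ε i) (n m i) ω)
      fun i => δ i (n m i) (SEC.sample (f i) (X i) (ε i) (n m i) ω)) (by
    rw [dist_pi_lt_iff hη]
    intro i
    rw [dist_pi_lt_iff hη]
    intro j
    rw [Real.dist_eq]
    have hij := abs_lt.1 (hclose i j)
    have hji := abs_lt.1 (hclose j i)
    have hii := abs_lt.1 (hclose i i)
    have hjj := abs_lt.1 (hclose j j)
    rw [norm_sub_rev] at hji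
    simp only [sub_self, norm_zero, ne_eq, OfNat.ofNat_ne_zero, not_false_eq_true, zero_pow,
      add_zero] at hii hjj
    set s := ‖x (κ i) - x (κ j)‖ ^ 2
    have hs : 0 ≤ s := by positivity
    -- The noise variance `b` cancels here. Two losses, each within `η / 4`, put one absolute value
    -- within `η / 2` of `s`, and the two absolute values add up to `η`.
    have key : ∀ u w b : ℝ, |u - (b + s)| < η / 4 → |w - b| < η / 4 →
        |(|u - w| - s)| < η / 2 := by
      intro u w b hu hw
      rw [abs_lt] at hu hw
      have h3 : |(|u - w| - |s|)| ≤ |u - w - s| := abs_abs_sub_abs_le _ _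
      rw [abs_of_nonneg hs] at h3
      refine h3.trans_lt (abs_lt.2 ⟨?_, ?_⟩) <;> linarith
    have k1 := abs_lt.1 (key _ _ _ (abs_lt.2 hij) (abs_lt.2 hjj))
    have k2 := abs_lt.1 (key _ _ _ (abs_lt.2 hji) (abs_lt.2 hii))
    rw [SEC.dissim]
    exact abs_lt.2 ⟨by linarith, by linarith⟩) (fun i j => add_comm _ _) U c hU hkm
  refine hbad fun i j => (hlab i j).trans ⟨fun h => ?_, fun h => ?_⟩
  · rw [← hκ i, ← hκ j, h]
  · rw [← hκ i, ← hκ j] at h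
    exact hae _ _ h
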